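/- **Setting.** Let $N\ge 1$ and $Y=\theta^*+W\in\mathbb R^N$, where $\theta^*\in\mathbb R^N$ is arbitrary and the random vector $W$ satisfies, for some $\rho>0$, $$\mathbb P\big(|\langle W,K\rangle|>t\big)\le e^{-\rho t^2/2}\quad\text{for all } t\ge 0 \text{ and all } K\in\mathbb R^N \text{ with } \|K\|=1. \tag{subG}$$ A structured linear model consists of a finite set $\mathcal T$, finite structure spaces $\mathcal Z_\tau$ ($\tau\in\mathcal T$), integers $\ell(\mathcal Z_\tau)\ge 1$, and, for each $Z\in\mathcal Z_\tau$, a linear operator $\mathscr X_Z:\mathbb R^{\ell(\mathcal Z_\tau)}\to\mathbb R^N$, identified with its matrix. Put $\bar{\mathcal Z}_\tau=\{Z\in\mathcal Z_\tau:\det(\mathscr X_Z^T\mathscr X_Z)>0\}$. Let $\epsilon(\mathcal Z_\tau)$, $\tau\in\mathcal T$, be real numbers with $$\epsilon(\mathcal Z_\tau)\ge \ell(\mathcal Z_\tau)+\log|\mathcal Z_\tau|\quad\text{for all }\tau\in\mathcal T, \tag{larger}$$ $$\big|\{\tau\in\mathcal T: t-1<\epsilon(\mathcal Z_\tau)\le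 t\}\big|\le t\quad\text{for all } t\in\mathbb N. \tag{capacity}$$ Given $\lambda,D>0$, the prior $\Pi$ on $(\tau,Z,Q)$ is defined by: (1) sample $\tau$ with probability proportional to $\frac{\Gamma(\ell(\mathcal Z_\tau))}{\Gamma(\ell(\mathcal Z_\tau)/2)}e^{-D\epsilon(\mathcal Z_\tau)}$ (among the $\tau$ with $\bar{\mathcal Z}_\tau\neq\emptyset$); (2) given $\tau$, sample $Z$ uniformly from $\bar{\mathcal Z}_\tau$; (3) given $(\tau,Z)$, sample $Q\in\mathbb R^{\ell(\mathcal Z_\tau)}$ from the elliptical Laplace density $$\frac{\sqrt{\det(\mathscr X_Z^T\mathscr X_Z)}}{2}\Big(\frac{\lambda}{\sqrt\pi}\Big)^{\ell(\mathcal Z_\tau)}\frac{\Gamma(\ell(\mathcal Z_\tau)/2)}{\Gamma(\ell(\mathcal Z_\tau))}\,e^{-\lambda\|\mathscr X_Z(Q)\|}.$$ Let $\Pi(\cdot\mid Y)$ be the posterior distribution given by Bayes' formula with the Gaussian likelihood $Y\mid(Z,Q)\sim N(\mathscr X_Z(Q),I_N)$. No assumption other than linearity is made on the operators $\mathscr X_Z$.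 **Theorem.** For all $\lambda,\rho>0$ and every $\delta\in(0,1)$ there is a constant $D_{\lambda,\delta,\rho}>0$ depending only on $\lambda,\delta,\rho$ such that for every $D>D_{\lambda,\delta,\rho}$ there are constants $M,C',C''>0$ depending only on $\lambda,\delta,\rho,D$ for which the following holds. For every setting as above satisfying (larger), (subG) and (capacity), every $\theta^*\in\mathbb R^N$, $\tau^*\in\mathcal T$, $Z^*\in\bar{\mathcal Z}_{\tau^*}$ and $Q^*\in\mathbb R^{\ell(\mathcal Z_{\tau^*})}$, $$\mathbb E\,\Pi\Big(\epsilon(\mathcal Z_\tau)>(1+\delta)\epsilon(\mathcal Z_{\tau^*})+\delta\|\mathscr X_{Z^*}(Q^*)-\theta^*\|^2\,\Big|\,Y\Big)\le \exp\Big(-C'\big(\epsilon(\mathcal Z_{\tau^*})+\|\mathscr X_{Z^*}(Q^*)-\theta^*\|^2\big)\Big)$$ and, with $\delta_2=8\sqrt{\delta/\rho}$, $$\mathbb E\,\Pi\Big(\|\mathscr X_Z(Q)-\theta^*\|^2>(1+\delta_2)\|\mathscr X_{Z^*}(Q^*)-\theta^*\|^2+M\epsilon(\mathcal Z_{\tau^*})\,\Big|\,Y\Big)\le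 \exp\Big(-C''\big(\epsilon(\mathcal Z_{\tau^*})+\|\mathscr X_{Z^*}(Q^*)-\theta^*\|^2\big)\Big).$$ -/

import Mathlib

open MeasureTheory

universe u v w

/-- A structured linear model with signals in `ℝ^N`: a finite set `Index` of structure indices `τ`,
for each `τ` a finite structure space `Struct τ` and a parameter dimension `dim τ`, and for each
structure `Z` a linear operator from `ℝ^(dim τ)` to `ℝ^N`, given by its matrix `design τ Z`. -/
structure StructuredLinearModel (N : ℕ) where
  Index : Type u
  Struct : Index → Type v
  [fintypeIndex : Fintype Index]
  [fintypeStruct : ∀ τ, Fintype (Struct τ)]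
  dim : Index → ℕ
  design : ∀ τ, Struct τ → Matrix (Fin N) (Fin (dim τ)) ℝ

namespace StructuredLinearModel

attribute [instance] StructuredLinearModel.fintypeIndex StructuredLinearModel.fintypeStruct

variable {N : ℕ} (S : StructuredLinearModel.{u, v} N)

/-- The signal: the linear operator of the structure `Z` applied to the parameter `Q`. -/
noncomputable def signal (τ : S.Index) (Z : S.Struct τ)
    (Q : EuclideanSpace ℝ (Fin (S.dim τ))) : EuclideanSpace ℝ (Fin N) :=
  WithLp.toLp 2 ((S.design τ Z).mulVec (WithLp.ofLp Q))

/-- The determinant of the Gram matrix of the operator of the structure `Z`. -/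
noncomputable def gramDet (τ : S.Index) (Z : S.Struct τ) : ℝ :=
  ((S.design τ Z).transpose * S.design τ Z).det

open Classical in
/-- The structures whose operator has a nonsingular Gram matrix. -/
noncomputable def regular (τ : S.Index) : Finset (S.Struct τ) :=
  Finset.univ.filter fun Z => 0 < S.gramDet τ Z

/-- The model complexity: effective dimension plus log-cardinality of the structure space. -/
noncomputable def complexity (τ : S.Index) : ℝ :=
  (S.dim τ : ℝ) + Real.log (Fintype.card (S.Struct τ) : ℝ)

/-- The density of the elliptical Laplace distribution. -/
noncomputable def laplaceDensity (lam : ℝ) (τ : S.Index) (Z : S.Struct τ)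
    (Q : EuclideanSpace ℝ (Fin (S.dim τ))) : ℝ :=
  Real.sqrt (S.gramDet τ Z) / 2 * (lam / Real.sqrt Real.pi) ^ (S.dim τ)
    * (Real.Gamma ((S.dim τ : ℝ) / 2) / Real.Gamma (S.dim τ : ℝ))
    * Real.exp (-(lam * ‖S.signal τ Z Q‖))

/-- The elliptical Laplace distribution on the parameter space `ℝ^(dim τ)`. -/
noncomputable def laplace (lam : ℝ) (τ : S.Index) (Z : S.Struct τ) :
    Measure (EuclideanSpace ℝ (Fin (S.dim τ))) :=
  volume.withDensity fun Q => ENNReal.ofReal (S.laplaceDensity lam τ Z Q)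

open Classical in
/-- Unnormalized model-selection weight of `τ`, with the Gamma correction factor. An index without
any regular structure has nothing to sample from in the second step, and gets weight zero. -/
noncomputable def modelWeight (ε : S.Index → ℝ) (D : ℝ) (τ : S.Index) : ℝ :=
  if (S.regular τ).Nonempty then
    Real.Gamma (S.dim τ : ℝ) / Real.Gamma ((S.dim τ : ℝ) / 2) * Real.exp (-(D * ε τ))
  else 0

/-- The model-selection prior on the index set. -/
noncomputable def modelPrior (ε : S.Index → ℝ) (D : ℝ) (τ : S.Index) : ℝ :=
  S.modelWeight ε D τ / ∑ τ' : S.Index, S.modelWeight ε D τ'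

/-- The space of triples `(τ, Z, Q)`, written `⟨⟨τ, Z⟩, Q⟩`. -/
abbrev Param : Type (max u v) :=
  Σ i : (Σ τ : S.Index, S.Struct τ), EuclideanSpace ℝ (Fin (S.dim i.1))

/-- The prior, as the law of `(τ, Z, Q)`: `τ` from the model-selection prior, then `Z` uniform
among the regular structures, then `Q` elliptical Laplace. -/
noncomputable def prior (ε : S.Index → ℝ) (D lam : ℝ) : Measure S.Param :=
  ∑ τ : S.Index, ∑ Z ∈ S.regular τ,
    ENNReal.ofReal (S.modelPrior ε D τ / ((S.regular τ).card : ℝ)) •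
      (S.laplace lam τ Z).map (fun Q => (⟨⟨τ, Z⟩, Q⟩ : S.Param))

/-- The density at `y` of the Gaussian distribution with mean the signal of `p` and identity
covariance. -/
noncomputable def likelihood (y : EuclideanSpace ℝ (Fin N)) (p : S.Param) : ℝ :=
  (Real.sqrt (2 * Real.pi))⁻¹ ^ N * Real.exp (-(‖y - S.signal p.1.1 p.1.2 p.2‖ ^ 2 / 2))

/-- The posterior distribution of `(τ, Z, Q)` given the observation `y` (Bayes' formula). -/
noncomputable def posterior (ε : S.Index → ℝ) (D lam : ℝ) (y : EuclideanSpace ℝ (Fin N)) :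
    Measure S.Param :=
  (∫⁻ p, ENNReal.ofReal (S.likelihood y p) ∂(S.prior ε D lam))⁻¹ •
    (S.prior ε D lam).withDensity fun p => ENNReal.ofReal (S.likelihood y p)

end StructuredLinearModel

/-- The sub-Gaussian tail condition with number `ρ` on a random vector `W`. -/
def SubGaussianVector {N : ℕ} {Ω : Type w} [MeasurableSpace Ω] (P : Measure Ω)
    (W : Ω → EuclideanSpace ℝ (Fin N)) (ρ : ℝ) : Prop :=
  ∀ K : EuclideanSpace ℝ (Fin N), ‖K‖ = 1 → ∀ t : ℝ, 0 ≤ t →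
    P {ω | t < |inner ℝ (W ω) K|} ≤ ENNReal.ofReal (Real.exp (-(ρ * t ^ 2 / 2)))

/-- The capacity condition on a complexity function. -/
def CapacityCondition {T : Type u} (ε : T → ℝ) : Prop :=
  ∀ t : ℕ, {τ : T | (t : ℝ) - 1 < ε τ ∧ ε τ ≤ (t : ℝ)}.ncard ≤ t

/-! The posterior mass of an event is a ratio of integrals against the prior. The denominator is
bounded below by the contribution of the reference structure alone, after shifting `Q` to the
reference parameter (`le_sqrt_det_mul_lintegral_laplace_gaussian`). The numerator is bounded above,
structure by structure, by a Gaussian integral in the signal. The factor `sqrt (gramDet)` of the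
Laplace density is the Jacobian of `Q ↦ signal`, and the Gamma factors of the two prior levels
cancel. What remains is exponential in the complexities, whatever the operators are.

The noise enters only through its projection onto a space of dimension at most `dim τ + 1` that
contains the difference of the two signals (`laplace_gaussian_exponent_le`). This leaves `exp
(‖projection‖ ^ 2 / η)`, whose expectation may be infinite. Since a posterior probability is at most
one, it is bounded by its own `s`-th power, and `x ↦ x ^ s` is subadditive. For `s ≤ η * ρ / 8` the
expectation is then finite by `lintegral_exp_norm_sq_projection_le`, with no exceptional noise event
to treat separately.

Summing over structures costs a multiple of `ε τ` by the lower bound on `ε`, and summing over `τ`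
another by the capacity condition. For large `D` the factor `exp (-(D * ε τ))` pays for both. On the
first event the gain comes from `ε τ - ε τ₀`, on the second from the distance of the signal to `θ`.
-/

section GaussianIntegral

/-! ### Gaussian integrals on a finite-dimensional inner product space. -/

variable {V : Type*} [NormedAddCommGroup V] [InnerProductSpace ℝ V] [FiniteDimensional ℝ V]
  [MeasurableSpace V] [BorelSpace V]

theorem integrable_exp_neg_mul_norm_sq {b : ℝ} (hb : 0 < b) :
    Integrable fun v : V => Real.exp (-(b * ‖v‖ ^ 2)) := by
  by_contra h
  -- A non-integrable function has Bochner integral zero, which contradicts the positive closed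
  -- form.
  have h1 := GaussianFourier.integral_rexp_neg_mul_sq_norm (V := V) hb
  simp only [neg_mul] at h1
  rw [integral_undef h] at h1
  have : 0 < (Real.pi / b) ^ ((Module.finrank ℝ V : ℝ) / 2) := by positivity
  linarith

theorem lintegral_exp_neg_mul_norm_sq {b : ℝ} (hb : 0 < b) :
    ∫⁻ v : V, ENNReal.ofReal (Real.exp (-(b * ‖v‖ ^ 2))) =
      ENNReal.ofReal ((Real.pi / b) ^ ((Module.finrank ℝ V : ℝ) / 2)) := by
  rw [← ofReal_integral_eq_lintegral_ofReal (integrable_exp_neg_mul_norm_sq hb)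
    (Filter.Eventually.of_forall fun _ => (Real.exp_pos _).le)]
  have h1 := GaussianFourier.integral_rexp_neg_mul_sq_norm (V := V) hb
  simp only [neg_mul] at h1
  rw [h1]

/-- Complete the square and translate. Read from right to left, it writes the exponential of a
square as a Gaussian average of exponentials linear in `x`. -/
theorem lintegral_exp_inner_sub_norm_sq {b : ℝ} (hb : 0 < b) (x : V) :
    ∫⁻ v : V, ENNReal.ofReal (Real.exp (inner ℝ x v - b * ‖v‖ ^ 2)) =
      ENNReal.ofReal (Real.exp (‖x‖ ^ 2 / (4 * b))) *
        ENNReal.ofReal ((Real.pi / b) ^ ((Module.finrank ℝ V : ℝ) / 2)) := by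
  have key : ∀ v : V, ENNReal.ofReal (Real.exp (inner ℝ x v - b * ‖v‖ ^ 2)) =
      ENNReal.ofReal (Real.exp (‖x‖ ^ 2 / (4 * b))) *
        ENNReal.ofReal (Real.exp (-(b * ‖v - (1 / (2 * b)) • x‖ ^ 2))) := by
    intro v
    rw [← ENNReal.ofReal_mul (Real.exp_pos _).le, ← Real.exp_add]
    congr 2
    rw [norm_sub_sq_real, norm_smul, mul_pow, inner_smul_right, real_inner_comm, Real.norm_eq_abs,
      sq_abs]
    field_simp
    ring
  simp_rw [key]
  rw [lintegral_const_mul _ (by fun_prop)]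
  congr 1
  rw [lintegral_sub_right_eq_self (fun v : V => ENNReal.ofReal (Real.exp (-(b * ‖v‖ ^ 2))))]
  exact lintegral_exp_neg_mul_norm_sq hb

end GaussianIntegral

/-! ### Exponential moments of sub-Gaussian vectors. -/

namespace SubGaussianVector

variable {N : ℕ} {Ω : Type w} [MeasurableSpace Ω] {P : Measure Ω}
  {W : Ω → EuclideanSpace ℝ (Fin N)} {ρ : ℝ}

/-- Layer cake: the tail `exp (-(ρ * t / 2))` of the square, integrated against the derivative `ρ /
4 * exp (ρ / 4 * t)`, contributes one; the value at `t = 0` contributes the other one. -/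
theorem lintegral_exp_inner_sq_le [IsProbabilityMeasure P] (h : SubGaussianVector P W ρ)
    (hW : Measurable W) (hρ : 0 < ρ) {K : EuclideanSpace ℝ (Fin N)} (hK : ‖K‖ = 1) :
    ∫⁻ ω, ENNReal.ofReal (Real.exp (ρ / 4 * inner ℝ (W ω) K ^ 2)) ∂P ≤ 2 := by
  have hc : (0 : ℝ) < ρ / 4 := by positivity
  have hmeas : Measurable fun ω => inner ℝ (W ω) K ^ 2 := by fun_prop
  have hint : ∀ x : ℝ, ∫ t in (0 : ℝ)..x, ρ / 4 * Real.exp (ρ / 4 * t) =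
      Real.exp (ρ / 4 * x) - 1 := by
    intro x
    have : ∀ t ∈ Set.uIcc 0 x, HasDerivAt (fun t => Real.exp (ρ / 4 * t))
        (ρ / 4 * Real.exp (ρ / 4 * t)) t := by
      intro t _
      have := ((hasDerivAt_id t).const_mul (ρ / 4)).exp
      simpa [mul_comm] using this
    rw [intervalIntegral.integral_eq_sub_of_hasDerivAt this
      (Continuous.intervalIntegrable (by fun_prop) _ _)]
    simp
  have hsplit : ∀ ω, ENNReal.ofReal (Real.exp (ρ / 4 * inner ℝ (W ω) K ^ 2)) =
      1 + ENNReal.ofReal (∫ t in (0 : ℝ)..inner ℝ (W ω) K ^ 2, ρ / 4 * Real.exp (ρ / 4 * t)) := by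
    intro ω
    have h1 : (1 : ℝ) ≤ Real.exp (ρ / 4 * inner ℝ (W ω) K ^ 2) := Real.one_le_exp (by positivity)
    rw [hint, ← ENNReal.ofReal_one, ← ENNReal.ofReal_add zero_le_one (by linarith)]
    congr 1
    ring
  simp_rw [hsplit]
  rw [lintegral_add_left measurable_const, lintegral_const, measure_univ, mul_one,
    lintegral_comp_eq_lintegral_meas_lt_mul P
      (Filter.Eventually.of_forall fun ω => sq_nonneg (inner ℝ (W ω) K)) hmeas.aemeasurable
      (fun t _ => Continuous.intervalIntegrable (by fun_prop) _ _)
      (Filter.Eventually.of_forall fun t => by positivity)]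
  have hbound : ∫⁻ t in Set.Ioi (0 : ℝ), P {ω | t < inner ℝ (W ω) K ^ 2} *
      ENNReal.ofReal (ρ / 4 * Real.exp (ρ / 4 * t)) ≤
      ∫⁻ t in Set.Ioi (0 : ℝ), ENNReal.ofReal (ρ / 4 * Real.exp (-(ρ / 4) * t)) := by
    refine setLIntegral_mono (by fun_prop) fun t ht => ?_
    have hset : {ω | t < inner ℝ (W ω) K ^ 2} = {ω | Real.sqrt t < |inner ℝ (W ω) K|} := by
      ext ω
      exact (by rw [Real.sqrt_lt (le_of_lt ht) (abs_nonneg _), sq_abs] :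
        t < inner ℝ (W ω) K ^ 2 ↔ Real.sqrt t < |inner ℝ (W ω) K|)
    rw [hset]
    refine (mul_le_mul_left (h K hK _ (Real.sqrt_nonneg t)) _).trans ?_
    rw [← ENNReal.ofReal_mul (Real.exp_pos _).le]
    refine ENNReal.ofReal_le_ofReal (le_of_eq ?_)
    rw [Real.sq_sqrt (le_of_lt ht), mul_left_comm, ← Real.exp_add]
    ring_nf
  have htot : ∫⁻ t in Set.Ioi (0 : ℝ), ENNReal.ofReal (ρ / 4 * Real.exp (-(ρ / 4) * t)) = 1 := by
    rw [← ofReal_integral_eq_lintegral_ofReal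
      ((exp_neg_integrableOn_Ioi 0 hc).const_mul (ρ / 4))
      (Filter.Eventually.of_forall fun t => by positivity), integral_const_mul,
      integral_exp_mul_Ioi (by linarith)]
    simp only [mul_zero, Real.exp_zero]
    rw [show ρ / 4 * (-1 / -(ρ / 4)) = 1 by field_simp, ENNReal.ofReal_one]
  calc _ ≤ (1 : ENNReal) + 1 := by gcongr; exact hbound.trans htot.le
    _ = 2 := one_add_one_eq_two

theorem lintegral_exp_inner_le [IsProbabilityMeasure P] (h : SubGaussianVector P W ρ)
    (hW : Measurable W) (hρ : 0 < ρ) (x : EuclideanSpace ℝ (Fin N)) :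
    ∫⁻ ω, ENNReal.ofReal (Real.exp (inner ℝ (W ω) x)) ∂P ≤
      2 * ENNReal.ofReal (Real.exp (‖x‖ ^ 2 / ρ)) := by
  rcases eq_or_ne x 0 with rfl | hx
  · simp
  have hx' : ‖x‖ ≠ 0 := norm_ne_zero_iff.2 hx
  set K : EuclideanSpace ℝ (Fin N) := ‖x‖⁻¹ • x with hKdef
  have hK : ‖K‖ = 1 := by rw [hKdef, norm_smul, norm_inv, norm_norm, inv_mul_cancel₀ hx']
  have hxK : x = ‖x‖ • K := by rw [hKdef, smul_smul, mul_inv_cancel₀ hx', one_smul]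
  calc ∫⁻ ω, ENNReal.ofReal (Real.exp (inner ℝ (W ω) x)) ∂P
      ≤ ∫⁻ ω, ENNReal.ofReal (Real.exp (‖x‖ ^ 2 / ρ)) *
          ENNReal.ofReal (Real.exp (ρ / 4 * inner ℝ (W ω) K ^ 2)) ∂P := by
        refine lintegral_mono fun ω => ?_
        rw [← ENNReal.ofReal_mul (Real.exp_pos _).le, ← Real.exp_add]
        refine ENNReal.ofReal_le_ofReal (Real.exp_le_exp.2 ?_)
        have h1 : inner ℝ (W ω) x = ‖x‖ * inner ℝ (W ω) K := by
          conv_lhs => rw [hxK]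
          rw [inner_smul_right]
        rw [h1]
        -- Young's inequality reduces the linear exponent to the quadratic one along the direction
        -- of `x`.
        have h2 : ‖x‖ ^ 2 / ρ + ρ / 4 * inner ℝ (W ω) K ^ 2 - ‖x‖ * inner ℝ (W ω) K =
            (‖x‖ - ρ / 2 * inner ℝ (W ω) K) ^ 2 / ρ := by field_simp; ring
        have h3 : 0 ≤ (‖x‖ - ρ / 2 * inner ℝ (W ω) K) ^ 2 / ρ := by positivity
        linarith
    _ = ENNReal.ofReal (Real.exp (‖x‖ ^ 2 / ρ)) *
          ∫⁻ ω, ENNReal.ofReal (Real.exp (ρ / 4 * inner ℝ (W ω) K ^ 2)) ∂P :=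
        lintegral_const_mul _ (by fun_prop)
    _ ≤ _ := by
        rw [mul_comm]
        gcongr
        exact h.lintegral_exp_inner_sq_le hW hρ hK

/-- The square is linearized by a Gaussian average over `V` with `b = 2 / ρ`, chosen so that `1 / (4
* b) = ρ / 8`. After Fubini, the linear moment bound uses up half of the Gaussian weight, and the
ratio of the two normalizing constants is `2 ^ (k / 2)`. -/
theorem lintegral_exp_norm_sq_projection_le [IsProbabilityMeasure P] (h : SubGaussianVector P W ρ)
    (hW : Measurable W) (hρ : 0 < ρ) (V : Submodule ℝ (EuclideanSpace ℝ (Fin N))) :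
    ∫⁻ ω, ENNReal.ofReal (Real.exp (ρ / 8 * ‖V.orthogonalProjectionOnto (W ω)‖ ^ 2)) ∂P ≤
      ENNReal.ofReal (2 ^ (1 + Module.finrank ℝ V)) := by
  set k := Module.finrank ℝ V
  have hb : 0 < 2 / ρ := by positivity
  set G : ℝ := (Real.pi / (2 / ρ)) ^ ((k : ℝ) / 2) with hG
  have hGpos : 0 < G := by positivity
  have hmeasV : Measurable fun ω => V.orthogonalProjectionOnto (W ω) :=
    V.orthogonalProjectionOnto.continuous.measurable.comp hW
  have hinner : ∀ ω (v : V), inner ℝ (V.orthogonalProjectionOnto (W ω)) v =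
      inner ℝ (W ω) (v : EuclideanSpace ℝ (Fin N)) := fun ω v => by
    rw [real_inner_comm, real_inner_comm (v : EuclideanSpace ℝ (Fin N))]
    exact Submodule.inner_orthogonalProjectionOnto_eq_of_mem_left v (W ω)
  have hgauss : ∀ ω, ENNReal.ofReal
      (Real.exp (ρ / 8 * ‖V.orthogonalProjectionOnto (W ω)‖ ^ 2)) * ENNReal.ofReal G =
      ∫⁻ v : V, ENNReal.ofReal (Real.exp
        (inner ℝ (V.orthogonalProjectionOnto (W ω)) v - 2 / ρ * ‖v‖ ^ 2)) := by
    intro ω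
    rw [lintegral_exp_inner_sub_norm_sq hb]
    congr 3
    field_simp
    ring
  have hmain : (∫⁻ ω, ENNReal.ofReal
      (Real.exp (ρ / 8 * ‖V.orthogonalProjectionOnto (W ω)‖ ^ 2)) ∂P) * ENNReal.ofReal G ≤
      ENNReal.ofReal (2 ^ (1 + k)) * ENNReal.ofReal G := by
    calc _ = ∫⁻ ω, (∫⁻ v : V, ENNReal.ofReal (Real.exp
        (inner ℝ (V.orthogonalProjectionOnto (W ω)) v - 2 / ρ * ‖v‖ ^ 2))) ∂P := by
          rw [← lintegral_mul_const _ (by fun_prop)]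
          exact lintegral_congr hgauss
      _ = ∫⁻ v : V, ∫⁻ ω, ENNReal.ofReal (Real.exp
        (inner ℝ (V.orthogonalProjectionOnto (W ω)) v - 2 / ρ * ‖v‖ ^ 2)) ∂P := by
          refine lintegral_lintegral_swap (Measurable.aemeasurable ?_)
          have h1 : Measurable fun p : Ω × V => V.orthogonalProjectionOnto (W p.1) :=
            hmeasV.comp measurable_fst
          simp only [Function.uncurry_def]
          fun_prop
      _ ≤ ∫⁻ v : V, 2 * ENNReal.ofReal (Real.exp (-(1 / ρ * ‖v‖ ^ 2))) := by
          refine lintegral_mono fun v => ?_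
          calc _ = ∫⁻ ω, ENNReal.ofReal (Real.exp (-(2 / ρ * ‖v‖ ^ 2))) *
                ENNReal.ofReal (Real.exp (inner ℝ (W ω) (v : EuclideanSpace ℝ (Fin N)))) ∂P := by
                refine lintegral_congr fun ω => ?_
                rw [← ENNReal.ofReal_mul (Real.exp_pos _).le, ← Real.exp_add, hinner]
                congr 2
                ring
            _ = ENNReal.ofReal (Real.exp (-(2 / ρ * ‖v‖ ^ 2))) *
                ∫⁻ ω, ENNReal.ofReal
                  (Real.exp (inner ℝ (W ω) (v : EuclideanSpace ℝ (Fin N)))) ∂P :=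
                lintegral_const_mul _ (by fun_prop)
            _ ≤ ENNReal.ofReal (Real.exp (-(2 / ρ * ‖v‖ ^ 2))) *
                (2 * ENNReal.ofReal (Real.exp (‖v‖ ^ 2 / ρ))) := by
                gcongr
                exact h.lintegral_exp_inner_le hW hρ v
            _ = _ := by
                rw [mul_left_comm, ← ENNReal.ofReal_mul (Real.exp_pos _).le, ← Real.exp_add]
                congr 3
                ring
      _ = 2 * ENNReal.ofReal ((Real.pi / (1 / ρ)) ^ ((k : ℝ) / 2)) := by
          rw [lintegral_const_mul _ (by fun_prop), lintegral_exp_neg_mul_norm_sq (by positivity)]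
      _ ≤ ENNReal.ofReal (2 ^ (1 + k)) * ENNReal.ofReal G := by
          rw [← ENNReal.ofReal_mul (by positivity), ← ENNReal.ofReal_ofNat,
            ← ENNReal.ofReal_mul (by positivity)]
          refine ENNReal.ofReal_le_ofReal ?_
          have h1 : (Real.pi / (1 / ρ)) ^ ((k : ℝ) / 2) = 2 ^ ((k : ℝ) / 2) * G := by
            rw [hG, ← Real.mul_rpow (by norm_num) (by positivity)]
            congr 1
            field_simp
          have h2 : (2 : ℝ) ^ ((k : ℝ) / 2) ≤ 2 ^ k := by
            rw [← Real.rpow_natCast]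
            exact Real.rpow_le_rpow_of_exponent_le (by norm_num)
              (half_le_self (Nat.cast_nonneg k))
          rw [h1, pow_add, pow_one, ← mul_assoc]
          gcongr
  exact (ENNReal.mul_le_mul_iff_left (ENNReal.ofReal_pos.2 hGpos).ne' ENNReal.ofReal_ne_top).1 hmain

end SubGaussianVector

/-! ### Integrals over the parameter, expressed through the signal. -/

section MatrixIntegral

variable {N l : ℕ} (A : Matrix (Fin N) (Fin l) ℝ)

open scoped MatrixOrder in
theorem Matrix.exists_transpose_mul_self_eq :
    ∃ B : Matrix (Fin l) (Fin l) ℝ, A.transpose * A = B.transpose * B := by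
  have h : (A.conjTranspose * A).PosSemidef := Matrix.posSemidef_conjTranspose_mul_self A
  obtain ⟨B, hB⟩ := CStarAlgebra.nonneg_iff_eq_star_mul_self.1 h.nonneg
  exact ⟨B, by simpa [Matrix.star_eq_conjTranspose, Matrix.conjTranspose_eq_transpose_of_trivial]
    using hB⟩

theorem norm_sq_toEuclideanLin (Q : EuclideanSpace ℝ (Fin l)) :
    ‖A.toEuclideanLin Q‖ ^ 2 = dotProduct Q.ofLp ((A.transpose * A).mulVec Q.ofLp) := by
  rw [← real_inner_self_eq_norm_sq, EuclideanSpace.inner_eq_star_dotProduct]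
  simp only [Matrix.toLpLin_apply, star_trivial]
  rw [← Matrix.mulVec_mulVec, Matrix.dotProduct_mulVec, ← Matrix.mulVec_transpose, dotProduct_comm]

/-- A square matrix `B` with the same Gram matrix gives the same norms, so the linear change of
variables applies with Jacobian `|det B|`. -/
theorem sqrt_det_mul_lintegral_comp_norm (hA : 0 < (A.transpose * A).det) {f : ℝ → ENNReal}
    (hf : Measurable f) :
    ENNReal.ofReal (Real.sqrt (A.transpose * A).det) *
        ∫⁻ Q : EuclideanSpace ℝ (Fin l), f ‖A.toEuclideanLin Q‖ =
      ∫⁻ x : EuclideanSpace ℝ (Fin l), f ‖x‖ := by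
  obtain ⟨B, hB⟩ := A.exists_transpose_mul_self_eq
  have hnorm : ∀ Q, ‖A.toEuclideanLin Q‖ = ‖B.toEuclideanLin Q‖ := fun Q => by
    rw [← sq_eq_sq₀ (norm_nonneg _) (norm_nonneg _), norm_sq_toEuclideanLin,
      norm_sq_toEuclideanLin, hB]
  have hdet : LinearMap.det B.toEuclideanLin = B.det := by
    rw [Matrix.toEuclideanLin_eq_toLin_orthonormal, LinearMap.det_toLin]
  have hsq : Real.sqrt (A.transpose * A).det = |B.det| := by
    rw [hB, Matrix.det_mul, Matrix.det_transpose, ← sq, Real.sqrt_sq_eq_abs]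
  have hne : B.det ≠ 0 := by
    intro h0
    rw [hB, Matrix.det_mul, h0, mul_zero] at hA
    exact lt_irrefl _ hA
  have hmap := Measure.map_linearMap_addHaar_eq_smul_addHaar
    (volume : Measure (EuclideanSpace ℝ (Fin l))) (f := B.toEuclideanLin) (by rwa [hdet])
  have hmeas : Measurable B.toEuclideanLin :=
    (LinearMap.continuous_of_finiteDimensional _).measurable
  simp_rw [hnorm]
  rw [← lintegral_map (f := fun x => f ‖x‖) (by fun_prop) hmeas, hmap, lintegral_smul_measure,
    hdet, hsq, smul_eq_mul, ← mul_assoc, ← ENNReal.ofReal_mul (abs_nonneg _), ← abs_mul,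
    mul_inv_cancel₀ hne, abs_one, ENNReal.ofReal_one, one_mul]

theorem sqrt_det_mul_lintegral_exp_neg_norm_sub_sq_le (hA : 0 < (A.transpose * A).det) {b : ℝ}
    (hb : 0 < b) (x : EuclideanSpace ℝ (Fin N)) :
    ENNReal.ofReal (Real.sqrt (A.transpose * A).det) *
        ∫⁻ Q : EuclideanSpace ℝ (Fin l),
          ENNReal.ofReal (Real.exp (-(b * ‖A.toEuclideanLin Q - x‖ ^ 2))) ≤
      ENNReal.ofReal ((Real.pi / b) ^ ((l : ℝ) / 2)) := by
  set V := LinearMap.range A.toEuclideanLin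
  -- `Q₁` parametrizes the point of the range nearest to `x`; projecting onto the range only
  -- shortens the residual, and a translation then centres the integral.
  obtain ⟨Q₁, hQ₁⟩ := (V.orthogonalProjectionOnto x).2
  have hle : ∀ Q, ‖A.toEuclideanLin (Q - Q₁)‖ ≤ ‖A.toEuclideanLin Q - x‖ := fun Q => by
    have h1 : A.toEuclideanLin (Q - Q₁) =
        V.orthogonalProjectionOnto (A.toEuclideanLin Q - x) := by
      rw [map_sub, map_sub, hQ₁, Submodule.coe_sub]
      congr 1
      exact (Submodule.starProjection_eq_self_iff.2 (LinearMap.mem_range_self _ Q)).symm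
    rw [h1]
    exact V.norm_orthogonalProjectionOnto_apply_le _
  calc _ ≤ ENNReal.ofReal (Real.sqrt (A.transpose * A).det) *
        ∫⁻ Q : EuclideanSpace ℝ (Fin l),
          ENNReal.ofReal (Real.exp (-(b * ‖A.toEuclideanLin (Q - Q₁)‖ ^ 2))) := by
        gcongr with Q
        exact hle Q
    _ = ENNReal.ofReal (Real.sqrt (A.transpose * A).det) *
        ∫⁻ Q : EuclideanSpace ℝ (Fin l),
          ENNReal.ofReal (Real.exp (-(b * ‖A.toEuclideanLin Q‖ ^ 2))) := by
        rw [lintegral_sub_right_eq_self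
          (fun Q => ENNReal.ofReal (Real.exp (-(b * ‖A.toEuclideanLin Q‖ ^ 2))))]
    _ = ∫⁻ x : EuclideanSpace ℝ (Fin l), ENNReal.ofReal (Real.exp (-(b * ‖x‖ ^ 2))) :=
        sqrt_det_mul_lintegral_comp_norm A hA
          (f := fun r => ENNReal.ofReal (Real.exp (-(b * r ^ 2)))) (by fun_prop)
    _ ≤ _ := by rw [lintegral_exp_neg_mul_norm_sq hb, finrank_euclideanSpace_fin]

/-- Averaging over `x` and `-x` replaces `exp (φ x)` by `cosh (φ x) ≥ 1`. This removes the cross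
term of the likelihood from the lower bound on the denominator. -/
theorem le_lintegral_mul_exp_of_even {E : Type*} [AddGroup E] [MeasurableSpace E]
    [MeasurableNeg E] {μ : Measure E} [μ.IsNegInvariant] {g : E → ENNReal} (hg : Measurable g)
    (hge : ∀ x, g (-x) = g x) {φ : E → ℝ} (hφ : Measurable φ) (hφo : ∀ x, φ (-x) = -φ x) :
    ∫⁻ x, g x ∂μ ≤ ∫⁻ x, g x * ENNReal.ofReal (Real.exp (φ x)) ∂μ := by
  have hneg : ∫⁻ x, g x * ENNReal.ofReal (Real.exp (φ x)) ∂μ =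
      ∫⁻ x, g x * ENNReal.ofReal (Real.exp (-φ x)) ∂μ := by
    rw [← lintegral_neg_eq_self]
    simp_rw [hge, hφo]
  have hsum : 2 * ∫⁻ x, g x ∂μ ≤ 2 * ∫⁻ x, g x * ENNReal.ofReal (Real.exp (φ x)) ∂μ := by
    rw [two_mul (∫⁻ x, g x * ENNReal.ofReal (Real.exp (φ x)) ∂μ)]
    nth_rewrite 2 [hneg]
    rw [← lintegral_add_left (by fun_prop), ← lintegral_const_mul _ hg]
    refine lintegral_mono fun x => ?_
    rw [← mul_add, mul_comm, ← ENNReal.ofReal_add (Real.exp_pos _).le (Real.exp_pos _).le]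
    gcongr
    rw [← ENNReal.ofReal_ofNat]
    refine ENNReal.ofReal_le_ofReal ?_
    have h1 := Real.one_le_cosh (φ x)
    rw [Real.cosh_eq] at h1
    linarith
  exact (ENNReal.mul_le_mul_iff_right two_ne_zero ENNReal.ofNat_ne_top).1 hsum

theorem le_sqrt_det_mul_lintegral_laplace_gaussian (hA : 0 < (A.transpose * A).det) {a : ℝ}
    (ha : 0 ≤ a) (y : EuclideanSpace ℝ (Fin N)) (Q₀ : EuclideanSpace ℝ (Fin l)) :
    ENNReal.ofReal (Real.exp (-(a * ‖A.toEuclideanLin Q₀‖) - ‖y - A.toEuclideanLin Q₀‖ ^ 2 / 2)) *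
        ENNReal.ofReal (Real.exp (-(a ^ 2 / 2)) * Real.pi ^ ((l : ℝ) / 2)) ≤
      ENNReal.ofReal (Real.sqrt (A.transpose * A).det) *
        ∫⁻ Q : EuclideanSpace ℝ (Fin l), ENNReal.ofReal
          (Real.exp (-(a * ‖A.toEuclideanLin Q‖) - ‖y - A.toEuclideanLin Q‖ ^ 2 / 2)) := by
  set T := A.toEuclideanLin
  have hT : Measurable T := (LinearMap.continuous_of_finiteDimensional T).measurable
  set c := Real.exp (-(a * ‖T Q₀‖) - ‖y - T Q₀‖ ^ 2 / 2)
  set g : EuclideanSpace ℝ (Fin l) → ENNReal :=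
    fun h => ENNReal.ofReal (Real.exp (-(a * ‖T h‖) - ‖T h‖ ^ 2 / 2)) with hg
  have hgm : Measurable g := by fun_prop
  have hgauss : ENNReal.ofReal (Real.exp (-(a ^ 2 / 2)) * Real.pi ^ ((l : ℝ) / 2)) ≤
      ENNReal.ofReal (Real.sqrt (A.transpose * A).det) * ∫⁻ h, g h := by
    rw [sqrt_det_mul_lintegral_comp_norm A hA
      (f := fun r => ENNReal.ofReal (Real.exp (-(a * r) - r ^ 2 / 2))) (by fun_prop)]
    have h1 := lintegral_exp_neg_mul_norm_sq (V := EuclideanSpace ℝ (Fin l)) one_pos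
    rw [finrank_euclideanSpace_fin, div_one] at h1
    rw [ENNReal.ofReal_mul (Real.exp_pos _).le, ← h1, ← lintegral_const_mul _ (by fun_prop)]
    refine lintegral_mono fun x => ?_
    rw [← ENNReal.ofReal_mul (Real.exp_pos _).le, ← Real.exp_add]
    refine ENNReal.ofReal_le_ofReal (Real.exp_le_exp.2 ?_)
    -- Here `a * ‖x‖ ≤ a ^ 2 / 2 + ‖x‖ ^ 2 / 2`, so the Laplace tail is absorbed into a Gaussian
    -- with `b = 1`.
    nlinarith [sq_nonneg (a - ‖x‖)]
  have hsymm : ∫⁻ h, g h ≤ ∫⁻ h, g h * ENNReal.ofReal (Real.exp (inner ℝ (y - T Q₀) (T h))) :=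
    le_lintegral_mul_exp_of_even hgm (fun x => by simp [hg]) (by fun_prop) (fun x => by simp)
  have hshift : ENNReal.ofReal c *
      ∫⁻ h, g h * ENNReal.ofReal (Real.exp (inner ℝ (y - T Q₀) (T h))) ≤
      ∫⁻ Q, ENNReal.ofReal (Real.exp (-(a * ‖T Q‖) - ‖y - T Q‖ ^ 2 / 2)) := by
    rw [← lintegral_add_right_eq_self (μ := volume) (fun Q => ENNReal.ofReal
      (Real.exp (-(a * ‖T Q‖) - ‖y - T Q‖ ^ 2 / 2))) Q₀, ← lintegral_const_mul _ (by fun_prop)]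
    refine lintegral_mono fun h => ?_
    rw [← ENNReal.ofReal_mul (Real.exp_pos _).le, ← ENNReal.ofReal_mul (Real.exp_pos _).le,
      ← Real.exp_add, ← Real.exp_add]
    refine ENNReal.ofReal_le_ofReal (Real.exp_le_exp.2 ?_)
    have h2 : y - T (h + Q₀) = (y - T Q₀) - T h := by rw [map_add]; abel
    have h3 : ‖T (h + Q₀)‖ ≤ ‖T h‖ + ‖T Q₀‖ := by rw [map_add]; exact norm_add_le _ _
    rw [h2, norm_sub_sq_real (y - T Q₀) (T h)]
    nlinarith [mul_le_mul_of_nonneg_left h3 ha]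
  calc _ ≤ ENNReal.ofReal c * (ENNReal.ofReal (Real.sqrt (A.transpose * A).det) *
        ∫⁻ h, g h * ENNReal.ofReal (Real.exp (inner ℝ (y - T Q₀) (T h)))) := by
        gcongr
        exact hgauss.trans (by gcongr)
    _ = ENNReal.ofReal (Real.sqrt (A.transpose * A).det) * (ENNReal.ofReal c *
        ∫⁻ h, g h * ENNReal.ofReal (Real.exp (inner ℝ (y - T Q₀) (T h)))) := by
        rw [mul_left_comm]
    _ ≤ _ := by gcongr

end MatrixIntegral

theorem ENNReal.rpow_sum_le_sum_rpow {ι : Type*} (s : Finset ι) (f : ι → ENNReal) {p : ℝ}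
    (hp0 : 0 < p) (hp1 : p ≤ 1) : (∑ i ∈ s, f i) ^ p ≤ ∑ i ∈ s, f i ^ p := by
  classical
  induction s using Finset.induction_on with
  | empty => simp [ENNReal.zero_rpow_of_pos hp0]
  | insert i s hi ih =>
    rw [Finset.sum_insert hi, Finset.sum_insert hi]
    exact (ENNReal.rpow_add_le_add_rpow _ _ hp0.le hp1).trans (by gcongr)

theorem Sigma.measurable_of_comp_mk {ι : Type*} {α : ι → Type*} [∀ i, MeasurableSpace (α i)]
    {β : Type*} [MeasurableSpace β] {f : (Σ i, α i) → β}
    (hf : ∀ i, Measurable fun x => f ⟨i, x⟩) : Measurable f := by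
  intro s hs
  exact MeasurableSpace.measurableSet_iInf.2 fun i => hf i hs

theorem Sigma.measurable_mk {ι : Type*} {α : ι → Type*} [∀ i, MeasurableSpace (α i)] (i : ι) :
    Measurable (Sigma.mk i : α i → Σ i, α i) := by
  intro s hs
  exact MeasurableSpace.measurableSet_iInf.1 hs i

/-! ### Posterior masses as ratios of explicit sums. -/

namespace StructuredLinearModel

variable {N : ℕ} (S : StructuredLinearModel.{u, v} N)

theorem measurable_signal (τ : S.Index) (Z : S.Struct τ) : Measurable (S.signal τ Z) :=
  (LinearMap.continuous_of_finiteDimensional (S.design τ Z).toEuclideanLin).measurable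

theorem measurable_likelihood (y : EuclideanSpace ℝ (Fin N)) : Measurable (S.likelihood y) := by
  refine Sigma.measurable_of_comp_mk fun i => ?_
  have := S.measurable_signal i.1 i.2
  exact (by fun_prop : Measurable fun Q => (Real.sqrt (2 * Real.pi))⁻¹ ^ N *
    Real.exp (-(‖y - S.signal i.1 i.2 Q‖ ^ 2 / 2)))

theorem measurable_laplaceDensity (lam : ℝ) (τ : S.Index) (Z : S.Struct τ) :
    Measurable (S.laplaceDensity lam τ Z) := by
  have := S.measurable_signal τ Z
  unfold laplaceDensity
  fun_prop

theorem gramDet_pos_of_mem_regular {τ : S.Index} {Z : S.Struct τ} (hZ : Z ∈ S.regular τ) :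
    0 < S.gramDet τ Z := by
  classical
  simpa [regular] using hZ

theorem lintegral_prior (ε : S.Index → ℝ) (D lam : ℝ) {f : S.Param → ENNReal}
    (hf : Measurable f) :
    ∫⁻ p, f p ∂S.prior ε D lam = ∑ τ, ∑ Z ∈ S.regular τ,
      ENNReal.ofReal (S.modelPrior ε D τ / ((S.regular τ).card : ℝ)) *
        ∫⁻ Q, ENNReal.ofReal (S.laplaceDensity lam τ Z Q) * f ⟨⟨τ, Z⟩, Q⟩ := by
  unfold prior
  rw [lintegral_finsetSum_measure]
  refine Finset.sum_congr rfl fun τ _ => ?_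
  rw [lintegral_finsetSum_measure]
  refine Finset.sum_congr rfl fun Z _ => ?_
  have hmk : Measurable fun Q => (⟨⟨τ, Z⟩, Q⟩ : S.Param) := Sigma.measurable_mk _
  have hd := S.measurable_laplaceDensity lam τ Z
  rw [lintegral_smul_measure, lintegral_map hf hmk, laplace, smul_eq_mul,
    lintegral_withDensity_eq_lintegral_mul _ (by fun_prop) (g := fun Q => f ⟨⟨τ, Z⟩, Q⟩)
      (hf.comp hmk)]
  rfl

/-- No information on the evidence integral is needed: `a⁻¹ * a ≤ 1` in `ENNReal` even for `a` zero
or infinite. -/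
theorem posterior_apply_le_one (ε : S.Index → ℝ) (D lam : ℝ) (y : EuclideanSpace ℝ (Fin N))
    (A : Set S.Param) : S.posterior ε D lam y A ≤ 1 := by
  refine (measure_mono (Set.subset_univ A)).trans ?_
  rw [posterior, Measure.smul_apply, withDensity_apply _ MeasurableSet.univ, setLIntegral_univ,
    smul_eq_mul]
  exact ENNReal.inv_mul_le_one _

/-- The common factor of the unnormalized posterior masses of the structures in `Struct τ`. -/
noncomputable def massFactor (ε : S.Index → ℝ) (D lam : ℝ) (τ : S.Index) : ℝ :=
  (Real.sqrt (2 * Real.pi))⁻¹ ^ N / (∑ τ', S.modelWeight ε D τ') *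
    (Real.exp (-(D * ε τ)) / ((S.regular τ).card : ℝ) * (lam / Real.sqrt Real.pi) ^ S.dim τ / 2)

theorem modelWeight_nonneg (ε : S.Index → ℝ) (D : ℝ) {τ : S.Index} (hd : 1 ≤ S.dim τ) :
    0 ≤ S.modelWeight ε D τ := by
  have hd' : (0 : ℝ) < S.dim τ := by exact_mod_cast hd
  have h1 := Real.Gamma_pos_of_pos hd'
  have h2 := Real.Gamma_pos_of_pos (half_pos hd')
  unfold modelWeight
  split_ifs
  · positivity
  · exact le_rfl

theorem sum_modelWeight_pos (ε : S.Index → ℝ) (D : ℝ) (hd : ∀ τ, 1 ≤ S.dim τ) {τ : S.Index}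
    (hτ : (S.regular τ).Nonempty) : 0 < ∑ τ', S.modelWeight ε D τ' := by
  refine Finset.sum_pos' (fun τ' _ => S.modelWeight_nonneg ε D (hd τ')) ⟨τ, Finset.mem_univ τ, ?_⟩
  have hd' : (0 : ℝ) < S.dim τ := by exact_mod_cast hd τ
  have h1 := Real.Gamma_pos_of_pos hd'
  have h2 := Real.Gamma_pos_of_pos (half_pos hd')
  rw [modelWeight, if_pos hτ]
  positivity

theorem massFactor_pos (ε : S.Index → ℝ) (D : ℝ) {lam : ℝ} (hlam : 0 < lam)
    (hd : ∀ τ, 1 ≤ S.dim τ) {τ : S.Index} (hτ : (S.regular τ).Nonempty) :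
    0 < S.massFactor ε D lam τ := by
  have h1 := S.sum_modelWeight_pos ε D hd hτ
  have h2 : (0 : ℝ) < (S.regular τ).card := by exact_mod_cast hτ.card_pos
  unfold massFactor
  positivity

/-- The Gamma ratio of the model weight is the inverse of the one in the Laplace density (`h3`), so
no factorial growth in the dimension survives. -/
theorem modelPrior_mul_laplaceDensity_mul_likelihood (ε : S.Index → ℝ) (D lam : ℝ)
    {τ : S.Index} (hd : 1 ≤ S.dim τ) {Z : S.Struct τ} (hZ : Z ∈ S.regular τ)
    (y : EuclideanSpace ℝ (Fin N)) (Q : EuclideanSpace ℝ (Fin (S.dim τ))) :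
    S.modelPrior ε D τ / ((S.regular τ).card : ℝ) *
        (S.laplaceDensity lam τ Z Q * S.likelihood y ⟨⟨τ, Z⟩, Q⟩) =
      S.massFactor ε D lam τ * (Real.sqrt (S.gramDet τ Z) *
        Real.exp (-(lam * ‖S.signal τ Z Q‖) - ‖y - S.signal τ Z Q‖ ^ 2 / 2)) := by
  have hd' : (0 : ℝ) < S.dim τ := by exact_mod_cast hd
  have h1 := (Real.Gamma_pos_of_pos hd').ne'
  have h2 := (Real.Gamma_pos_of_pos (half_pos hd')).ne'
  rw [modelPrior, modelWeight, if_pos ⟨Z, hZ⟩, laplaceDensity, likelihood, massFactor,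
    sub_eq_add_neg (-(lam * ‖S.signal τ Z Q‖)), Real.exp_add]
  generalize Real.Gamma (S.dim τ : ℝ) = g₁ at *
  generalize Real.Gamma ((S.dim τ : ℝ) / 2) = g₂ at *
  have h3 : g₁ / g₂ * (g₂ / g₁) = 1 := by field_simp
  linear_combination ((Real.sqrt (2 * Real.pi))⁻¹ ^ N / (∑ τ', S.modelWeight ε D τ') *
    (Real.exp (-(D * ε τ)) / ((S.regular τ).card : ℝ) * (lam / Real.sqrt Real.pi) ^ S.dim τ / 2)) *
      (Real.sqrt (S.gramDet τ Z) * (Real.exp (-(lam * ‖S.signal τ Z Q‖)) *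
        Real.exp (-(‖y - S.signal τ Z Q‖ ^ 2 / 2)))) * h3

theorem prior_mass_eq (ε : S.Index → ℝ) (D : ℝ) {lam : ℝ} (hlam : 0 < lam)
    (hd : ∀ τ, 1 ≤ S.dim τ) {τ : S.Index} {Z : S.Struct τ} (hZ : Z ∈ S.regular τ)
    (y : EuclideanSpace ℝ (Fin N)) {B : Set (EuclideanSpace ℝ (Fin (S.dim τ)))}
    (hB : MeasurableSet B) :
    ENNReal.ofReal (S.modelPrior ε D τ / ((S.regular τ).card : ℝ)) *
        ∫⁻ Q in B, ENNReal.ofReal (S.laplaceDensity lam τ Z Q) *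
          ENNReal.ofReal (S.likelihood y ⟨⟨τ, Z⟩, Q⟩) =
      ENNReal.ofReal (S.massFactor ε D lam τ) * (ENNReal.ofReal (Real.sqrt (S.gramDet τ Z)) *
        ∫⁻ Q in B, ENNReal.ofReal
          (Real.exp (-(lam * ‖S.signal τ Z Q‖) - ‖y - S.signal τ Z Q‖ ^ 2 / 2))) := by
  have hd' : (0 : ℝ) < S.dim τ := by exact_mod_cast hd τ
  have h1 := Real.Gamma_pos_of_pos hd'
  have h2 := Real.Gamma_pos_of_pos (half_pos hd')
  have hsig := S.measurable_signal τ Z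
  have hlap := S.measurable_laplaceDensity lam τ Z
  have hlik : Measurable fun Q => S.likelihood y ⟨⟨τ, Z⟩, Q⟩ :=
    (S.measurable_likelihood y).comp (Sigma.measurable_mk _)
  have hp : 0 ≤ S.modelPrior ε D τ / ((S.regular τ).card : ℝ) :=
    div_nonneg (div_nonneg (S.modelWeight_nonneg ε D (hd τ))
      (Finset.sum_nonneg fun τ' _ => S.modelWeight_nonneg ε D (hd τ'))) (Nat.cast_nonneg _)
  have hm := (S.massFactor_pos ε D hlam hd ⟨Z, hZ⟩).le
  rw [← lintegral_const_mul _ (by fun_prop), ← lintegral_const_mul _ (by fun_prop),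
    ← lintegral_const_mul _ (by fun_prop)]
  refine setLIntegral_congr_fun hB fun Q _ => ?_
  have hl : 0 ≤ S.laplaceDensity lam τ Z Q := by unfold laplaceDensity; positivity
  rw [← ENNReal.ofReal_mul hl, ← ENNReal.ofReal_mul hp, ← ENNReal.ofReal_mul (Real.sqrt_nonneg _),
    ← ENNReal.ofReal_mul hm, S.modelPrior_mul_laplaceDensity_mul_likelihood ε D lam (hd τ) hZ]

theorem setLIntegral_likelihood_prior (ε : S.Index → ℝ) (D : ℝ) {lam : ℝ} (hlam : 0 < lam)
    (hd : ∀ τ, 1 ≤ S.dim τ) (y : EuclideanSpace ℝ (Fin N)) {A : Set S.Param}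
    (hA : MeasurableSet A) :
    ∫⁻ p in A, ENNReal.ofReal (S.likelihood y p) ∂S.prior ε D lam =
      ∑ τ, ∑ Z ∈ S.regular τ, ENNReal.ofReal (S.massFactor ε D lam τ) *
        (ENNReal.ofReal (Real.sqrt (S.gramDet τ Z)) *
          ∫⁻ Q in (fun Q => (⟨⟨τ, Z⟩, Q⟩ : S.Param)) ⁻¹' A, ENNReal.ofReal
            (Real.exp (-(lam * ‖S.signal τ Z Q‖) - ‖y - S.signal τ Z Q‖ ^ 2 / 2))) := by
  have hlik := S.measurable_likelihood y
  rw [← lintegral_indicator hA, S.lintegral_prior ε D lam (by measurability)]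
  refine Finset.sum_congr rfl fun τ _ => Finset.sum_congr rfl fun Z hZ => ?_
  have hB : MeasurableSet ((fun Q => (⟨⟨τ, Z⟩, Q⟩ : S.Param)) ⁻¹' A) := Sigma.measurable_mk _ hA
  rw [← S.prior_mass_eq ε D hlam hd hZ y hB, ← lintegral_indicator hB]
  congr 2
  funext Q
  by_cases hQ : (⟨⟨τ, Z⟩, Q⟩ : S.Param) ∈ A
  · rw [Set.indicator_of_mem hQ, Set.indicator_of_mem (Set.mem_preimage.2 hQ)]
  · rw [Set.indicator_of_notMem hQ, Set.indicator_of_notMem (mt Set.mem_preimage.1 hQ), mul_zero]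

theorem le_lintegral_likelihood_prior (ε : S.Index → ℝ) (D : ℝ) {lam : ℝ} (hlam : 0 < lam)
    (hd : ∀ τ, 1 ≤ S.dim τ) (y : EuclideanSpace ℝ (Fin N)) {τ : S.Index} {Z : S.Struct τ}
    (hZ : Z ∈ S.regular τ) (Q : EuclideanSpace ℝ (Fin (S.dim τ))) :
    ENNReal.ofReal (S.massFactor ε D lam τ *
        (Real.exp (-(lam * ‖S.signal τ Z Q‖) - ‖y - S.signal τ Z Q‖ ^ 2 / 2) *
          (Real.exp (-(lam ^ 2 / 2)) * Real.pi ^ ((S.dim τ : ℝ) / 2)))) ≤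
      ∫⁻ p, ENNReal.ofReal (S.likelihood y p) ∂S.prior ε D lam := by
  have hm := (S.massFactor_pos ε D hlam hd ⟨Z, hZ⟩).le
  rw [← setLIntegral_univ, S.setLIntegral_likelihood_prior ε D hlam hd y MeasurableSet.univ,
    ENNReal.ofReal_mul hm, ENNReal.ofReal_mul (Real.exp_pos _).le]
  refine le_trans ?_ (Finset.single_le_sum (fun _ _ => zero_le) (Finset.mem_univ τ))
  refine le_trans ?_ (Finset.single_le_sum (fun _ _ => zero_le) hZ)
  refine mul_le_mul_right ?_ _
  rw [Set.preimage_univ, Measure.restrict_univ]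
  exact le_sqrt_det_mul_lintegral_laplace_gaussian (S.design τ Z)
    (S.gramDet_pos_of_mem_regular hZ) hlam.le y Q

/-- The part `η * ‖signal - x‖ ^ 2` kept in reserve in `hF` makes the integral over `Q` converge,
and its determinant cancels that of the prior. -/
theorem setLIntegral_likelihood_prior_le (ε : S.Index → ℝ) (D : ℝ) {lam : ℝ} (hlam : 0 < lam)
    (hd : ∀ τ, 1 ≤ S.dim τ) (x y : EuclideanSpace ℝ (Fin N)) {A : Set S.Param}
    (hA : MeasurableSet A) (T : Finset S.Index) (hT : ∀ p ∈ A, p.1.1 ∈ T) {η : ℝ} (hη : 0 < η)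
    (F : ∀ τ, S.Struct τ → ℝ)
    (hF : ∀ p ∈ A, -(lam * ‖S.signal p.1.1 p.1.2 p.2‖) - ‖y - S.signal p.1.1 p.1.2 p.2‖ ^ 2 / 2 ≤
      F p.1.1 p.1.2 - η * ‖S.signal p.1.1 p.1.2 p.2 - x‖ ^ 2) :
    ∫⁻ p in A, ENNReal.ofReal (S.likelihood y p) ∂S.prior ε D lam ≤
      ∑ τ ∈ T, ∑ Z ∈ S.regular τ, ENNReal.ofReal (S.massFactor ε D lam τ *
        (Real.exp (F τ Z) * (Real.pi / η) ^ ((S.dim τ : ℝ) / 2))) := by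
  rw [S.setLIntegral_likelihood_prior ε D hlam hd y hA,
    ← Finset.sum_subset (Finset.subset_univ T) (fun τ _ hτ => ?_)]
  · refine Finset.sum_le_sum fun τ _ => Finset.sum_le_sum fun Z hZ => ?_
    have hsig := S.measurable_signal τ Z
    rw [ENNReal.ofReal_mul (S.massFactor_pos ε D hlam hd ⟨Z, hZ⟩).le,
      ENNReal.ofReal_mul (Real.exp_pos _).le]
    refine mul_le_mul_right ?_ _
    calc _ ≤ ENNReal.ofReal (Real.sqrt (S.gramDet τ Z)) *
          ∫⁻ Q in (fun Q => (⟨⟨τ, Z⟩, Q⟩ : S.Param)) ⁻¹' A, ENNReal.ofReal (Real.exp (F τ Z)) *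
            ENNReal.ofReal (Real.exp (-(η * ‖S.signal τ Z Q - x‖ ^ 2))) := by
          refine mul_le_mul_right ?_ _
          refine setLIntegral_mono (by fun_prop) fun Q hQ => ?_
          rw [← ENNReal.ofReal_mul (Real.exp_pos _).le, ← Real.exp_add, ← sub_eq_add_neg]
          exact ENNReal.ofReal_le_ofReal (Real.exp_le_exp.2 (hF ⟨⟨τ, Z⟩, Q⟩ hQ))
      _ ≤ ENNReal.ofReal (Real.sqrt (S.gramDet τ Z)) *
          ∫⁻ Q, ENNReal.ofReal (Real.exp (F τ Z)) *
            ENNReal.ofReal (Real.exp (-(η * ‖S.signal τ Z Q - x‖ ^ 2))) := by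
          gcongr
          exact Measure.restrict_le_self
      _ = ENNReal.ofReal (Real.exp (F τ Z)) * (ENNReal.ofReal (Real.sqrt (S.gramDet τ Z)) *
          ∫⁻ Q, ENNReal.ofReal (Real.exp (-(η * ‖S.signal τ Z Q - x‖ ^ 2)))) := by
          rw [lintegral_const_mul _ (by fun_prop), mul_left_comm]
      _ ≤ _ := by
          gcongr
          exact sqrt_det_mul_lintegral_exp_neg_norm_sub_sq_le (S.design τ Z)
            (S.gramDet_pos_of_mem_regular hZ) hη x
  · refine Finset.sum_eq_zero fun Z _ => ?_
    have : (fun Q => (⟨⟨τ, Z⟩, Q⟩ : S.Param)) ⁻¹' A = ∅ :=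
      Set.eq_empty_of_forall_notMem fun Q hQ => hτ (hT _ hQ)
    rw [this]
    simp

theorem posterior_apply_le_sum (ε : S.Index → ℝ) (D : ℝ) {lam : ℝ} (hlam : 0 < lam)
    (hd : ∀ τ, 1 ≤ S.dim τ) (x y : EuclideanSpace ℝ (Fin N)) {A : Set S.Param}
    (hA : MeasurableSet A) (T : Finset S.Index) (hT : ∀ p ∈ A, p.1.1 ∈ T) {η : ℝ} (hη : 0 < η)
    {τ₀ : S.Index} {Z₀ : S.Struct τ₀} (hZ₀ : Z₀ ∈ S.regular τ₀)
    (Q₀ : EuclideanSpace ℝ (Fin (S.dim τ₀))) (F : ∀ τ, S.Struct τ → ℝ)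
    (hF : ∀ p ∈ A, -(lam * ‖S.signal p.1.1 p.1.2 p.2‖) - ‖y - S.signal p.1.1 p.1.2 p.2‖ ^ 2 / 2 ≤
      -(lam * ‖S.signal τ₀ Z₀ Q₀‖) - ‖y - S.signal τ₀ Z₀ Q₀‖ ^ 2 / 2 +
        F p.1.1 p.1.2 - η * ‖S.signal p.1.1 p.1.2 p.2 - x‖ ^ 2)
    {s : ℝ} (hs0 : 0 < s) (hs1 : s ≤ 1) :
    S.posterior ε D lam y A ≤ ∑ τ ∈ T, ∑ Z ∈ S.regular τ,
      ENNReal.ofReal (S.massFactor ε D lam τ * (Real.pi / η) ^ ((S.dim τ : ℝ) / 2) /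
        (S.massFactor ε D lam τ₀ * (Real.exp (-(lam ^ 2 / 2)) *
          Real.pi ^ ((S.dim τ₀ : ℝ) / 2))) * Real.exp (F τ Z)) ^ s := by
  set E := -(lam * ‖S.signal τ₀ Z₀ Q₀‖) - ‖y - S.signal τ₀ Z₀ Q₀‖ ^ 2 / 2 with hE
  have hm₀ := S.massFactor_pos ε D hlam hd ⟨Z₀, hZ₀⟩
  have hle : S.posterior ε D lam y A ≤ ∑ τ ∈ T, ∑ Z ∈ S.regular τ,
      ENNReal.ofReal (S.massFactor ε D lam τ * (Real.pi / η) ^ ((S.dim τ : ℝ) / 2) /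
        (S.massFactor ε D lam τ₀ * (Real.exp (-(lam ^ 2 / 2)) *
          Real.pi ^ ((S.dim τ₀ : ℝ) / 2))) * Real.exp (F τ Z)) := by
    rw [posterior, Measure.smul_apply, withDensity_apply _ hA, smul_eq_mul]
    refine (mul_le_mul' (ENNReal.inv_le_inv.2
      (S.le_lintegral_likelihood_prior ε D hlam hd y hZ₀ Q₀))
      (S.setLIntegral_likelihood_prior_le ε D hlam hd x y hA T hT hη
        (fun τ Z => E + F τ Z) hF)).trans (le_of_eq ?_)
    rw [Finset.mul_sum]
    refine Finset.sum_congr rfl fun τ _ => ?_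
    rw [Finset.mul_sum]
    refine Finset.sum_congr rfl fun Z _ => ?_
    rw [← hE, ← ENNReal.ofReal_inv_of_pos (by positivity), ← ENNReal.ofReal_mul (by positivity),
      Real.exp_add]
    congr 1
    field_simp
  -- A number in `[0, 1]` is at most its `s`-th power; subadditivity then moves the power inside the
  -- sums.
  calc S.posterior ε D lam y A ≤ S.posterior ε D lam y A ^ s :=
        by
        simpa using ENNReal.rpow_le_rpow_of_exponent_ge (S.posterior_apply_le_one ε D lam y A) hs1
    _ ≤ _ := ENNReal.rpow_le_rpow hle hs0.le
    _ ≤ _ := ENNReal.rpow_sum_le_sum_rpow _ _ hs0 hs1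
    _ ≤ _ := Finset.sum_le_sum fun τ _ => ENNReal.rpow_sum_le_sum_rpow _ _ hs0 hs1

end StructuredLinearModel

/-! ### Counting: sums over indices and structures. -/

theorem CapacityCondition.sum_exp_neg_le_one {T : Type u} [Fintype T] {ε : T → ℝ}
    (h : CapacityCondition ε) (hε : ∀ τ, 1 ≤ ε τ) : ∑ τ, Real.exp (-(4 * ε τ)) ≤ 1 := by
  classical
  have hceil : ∀ τ, 1 ≤ ⌈ε τ⌉₊ := fun τ =>
    Nat.one_le_iff_ne_zero.2 (Nat.ceil_pos.2 (by linarith [hε τ])).ne'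
  set n := ∑ τ, ⌈ε τ⌉₊
  have hmaps : ∀ τ ∈ (Finset.univ : Finset T), ⌈ε τ⌉₊ ∈ Finset.Icc 1 n := fun τ hτ =>
    Finset.mem_Icc.2 ⟨hceil τ,
      Finset.single_le_sum (f := fun τ => ⌈ε τ⌉₊) (fun _ _ => Nat.zero_le _) hτ⟩
  rw [← Finset.sum_fiberwise_of_maps_to hmaps]
  have hfib : ∀ t ∈ Finset.Icc 1 n,
      ∑ τ with ⌈ε τ⌉₊ = t, Real.exp (-(4 * ε τ)) ≤ (1 / 2 : ℝ) ^ t := by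
    intro t ht
    have ht1 : (1 : ℝ) ≤ t := by exact_mod_cast (Finset.mem_Icc.1 ht).1
    have hcard : (Finset.univ.filter fun τ => ⌈ε τ⌉₊ = t).card ≤ t := by
      refine le_trans (le_of_eq ?_) (h t)
      rw [← Set.ncard_coe_finset]
      congr 1
      ext τ
      rw [Finset.coe_filter]
      have h1 := Nat.ceil_eq_iff (a := ε τ) (n := t) (by have := (Finset.mem_Icc.1 ht).1; omega)
      rw [Nat.cast_sub (Finset.mem_Icc.1 ht).1, Nat.cast_one] at h1
      exact (and_iff_right (Finset.mem_univ τ)).trans h1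
    have hterm : ∀ τ ∈ Finset.univ.filter fun τ => ⌈ε τ⌉₊ = t,
        Real.exp (-(4 * ε τ)) ≤ Real.exp (-(2 * t)) := by
      intro τ hτ
      have h1 : ⌈ε τ⌉₊ = t := (Finset.mem_filter.1 hτ).2
      have h2 : (t : ℝ) < ε τ + 1 := h1 ▸ Nat.ceil_lt_add_one (by linarith [hε τ])
      -- From `t < ε τ + 1` and `1 ≤ ε τ` follows `t ≤ 2 * ε τ`. With at most `t` indices per level,
      -- level `t` contributes at most `t * exp (-(2 * t)) ≤ 2 ^ (-t)`.
      exact Real.exp_le_exp.2 (by linarith [hε τ])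
    calc _ ≤ (Finset.univ.filter fun τ => ⌈ε τ⌉₊ = t).card • Real.exp (-(2 * t)) :=
          Finset.sum_le_card_nsmul _ _ _ hterm
      _ ≤ (t : ℝ) * Real.exp (-(2 * t)) := by
          rw [nsmul_eq_mul]
          gcongr
      _ ≤ Real.exp t * Real.exp (-(2 * t)) := by
          gcongr
          linarith [Real.add_one_le_exp (t : ℝ)]
      _ = Real.exp (-1) ^ t := by
          rw [← Real.exp_add, ← Real.exp_nat_mul]
          ring_nf
      _ ≤ _ := by
          gcongr
          rw [Real.exp_neg, one_div]
          gcongr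
          linarith [Real.add_one_le_exp (1 : ℝ)]
  refine (Finset.sum_le_sum hfib).trans ?_
  have hgeom : ∀ m : ℕ, ∑ t ∈ Finset.Icc 1 m, (1 / 2 : ℝ) ^ t = 1 - (1 / 2) ^ m := by
    intro m
    induction m with
    | zero => simp
    | succ m ih =>
      rw [Finset.sum_Icc_succ_top (by omega), ih]
      ring
  rw [hgeom]
  have : (0 : ℝ) < (1 / 2) ^ n := by positivity
  linarith

theorem pow_le_exp_abs_log_mul {c : ℝ} (hc : 0 < c) (n : ℕ) :
    c ^ n ≤ Real.exp (|Real.log c| * n) := by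
  rw [← Real.rpow_natCast, Real.rpow_def_of_pos hc]
  gcongr
  exact le_abs_self _

namespace StructuredLinearModel

variable {N : ℕ} (S : StructuredLinearModel.{u, v} N)

theorem card_regular_le (τ : S.Index) : (S.regular τ).card ≤ Fintype.card (S.Struct τ) :=
  Finset.card_le_univ _

theorem card_regular_mul_exp_dim_le {ε : S.Index → ℝ} {τ : S.Index}
    (hε : S.complexity τ ≤ ε τ) : ((S.regular τ).card : ℝ) * Real.exp (S.dim τ) ≤
      Real.exp (ε τ) := by
  -- An empty structure space is treated apart, because `Real.log 0 = 0` breaks `exp (log card) =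
  -- card`.
  rcases Nat.eq_zero_or_pos (Fintype.card (S.Struct τ)) with h0 | hpos
  · have : (S.regular τ).card = 0 := Nat.le_zero.1 (h0 ▸ S.card_regular_le τ)
    rw [this, Nat.cast_zero, zero_mul]
    positivity
  · have hpos' : (0 : ℝ) < Fintype.card (S.Struct τ) := by exact_mod_cast hpos
    calc _ ≤ (Fintype.card (S.Struct τ) : ℝ) * Real.exp (S.dim τ) := by
          gcongr
          exact S.card_regular_le τ
      _ = Real.exp (S.complexity τ) := by
          rw [complexity, Real.exp_add, Real.exp_log hpos', mul_comm]
      _ ≤ _ := Real.exp_le_exp.2 hε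

theorem dim_le_of_complexity_le {ε : S.Index → ℝ} {τ : S.Index}
    (hε : S.complexity τ ≤ ε τ) : (S.dim τ : ℝ) ≤ ε τ := by
  have : 0 ≤ Real.log (Fintype.card (S.Struct τ) : ℝ) := Real.log_natCast_nonneg _
  unfold complexity at hε
  linarith

/-- The Gaussian constant, the total prior weight and the powers of `π` cancel. The remaining powers
of `lam` and `lam / sqrt η` are exponential in the dimensions, hence in `ε τ₀` and `ε τ`. -/
theorem massFactor_ratio_le {ε : S.Index → ℝ} {D lam : ℝ} (hlam : 0 < lam)
    (hd : ∀ τ, 1 ≤ S.dim τ) (hε : ∀ τ, S.complexity τ ≤ ε τ) {η : ℝ} (hη : 0 < η)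
    {τ τ₀ : S.Index} (hτ : (S.regular τ).Nonempty) (hτ₀ : (S.regular τ₀).Nonempty) :
    S.massFactor ε D lam τ * (Real.pi / η) ^ ((S.dim τ : ℝ) / 2) /
        (S.massFactor ε D lam τ₀ * (Real.exp (-(lam ^ 2 / 2)) *
          Real.pi ^ ((S.dim τ₀ : ℝ) / 2))) ≤
      Real.exp (-(D * (ε τ - ε τ₀)) + (1 + |Real.log lam| + lam ^ 2 / 2) * ε τ₀ +
        |Real.log (lam / Real.sqrt η)| * ε τ) := by
  have hpi := Real.pi_pos
  have hdim := S.dim_le_of_complexity_le (hε τ)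
  have hdim₀ := S.dim_le_of_complexity_le (hε τ₀)
  have hε₀ : 1 ≤ ε τ₀ := le_trans (by exact_mod_cast hd τ₀) hdim₀
  have hW := S.sum_modelWeight_pos ε D hd hτ₀
  have hn : (1 : ℝ) ≤ (S.regular τ).card := by exact_mod_cast hτ.card_pos
  have hn₀ : (1 : ℝ) ≤ (S.regular τ₀).card := by exact_mod_cast hτ₀.card_pos
  have hcard₀ : ((S.regular τ₀).card : ℝ) ≤ Real.exp (ε τ₀) :=
    le_trans (le_mul_of_one_le_right (Nat.cast_nonneg _) (Real.one_le_exp (Nat.cast_nonneg _)))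
      (S.card_regular_mul_exp_dim_le (hε τ₀))
  have h1 : (lam / Real.sqrt Real.pi) ^ S.dim τ * (Real.pi / η) ^ ((S.dim τ : ℝ) / 2) =
      (lam / Real.sqrt η) ^ S.dim τ := by
    rw [Real.rpow_div_two_eq_sqrt _ (by positivity), Real.rpow_natCast, ← mul_pow,
      Real.sqrt_div hpi.le]
    congr 1
    field_simp
  have h2 : (lam / Real.sqrt Real.pi) ^ S.dim τ₀ * Real.pi ^ ((S.dim τ₀ : ℝ) / 2) =
      lam ^ S.dim τ₀ := by
    rw [Real.rpow_div_two_eq_sqrt _ hpi.le, Real.rpow_natCast, ← mul_pow,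
      div_mul_cancel₀ _ (by positivity)]
  have hL := pow_le_exp_abs_log_mul (div_pos hlam (Real.sqrt_pos.2 hη)) (S.dim τ)
  have hL₀ := pow_le_exp_abs_log_mul (inv_pos.2 hlam) (S.dim τ₀)
  rw [Real.log_inv, abs_neg] at hL₀
  have heq : S.massFactor ε D lam τ * (Real.pi / η) ^ ((S.dim τ : ℝ) / 2) /
        (S.massFactor ε D lam τ₀ * (Real.exp (-(lam ^ 2 / 2)) *
          Real.pi ^ ((S.dim τ₀ : ℝ) / 2))) =
      Real.exp (-(D * (ε τ - ε τ₀))) * (((S.regular τ₀).card : ℝ) / (S.regular τ).card) *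
        (lam⁻¹ ^ S.dim τ₀ * Real.exp (lam ^ 2 / 2)) * (lam / Real.sqrt η) ^ S.dim τ := by
    have h3 : Real.exp (-(D * (ε τ - ε τ₀))) = Real.exp (-(D * ε τ)) / Real.exp (-(D * ε τ₀)) := by
      rw [← Real.exp_sub]
      ring_nf
    rw [massFactor, massFactor, ← h1, h3, inv_pow lam, ← h2, Real.exp_neg (lam ^ 2 / 2)]
    field_simp
  have hratio : ((S.regular τ₀).card : ℝ) / (S.regular τ).card ≤ Real.exp (ε τ₀) :=
    (div_le_self (Nat.cast_nonneg _) hn).trans hcard₀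
  rw [heq]
  calc _ ≤ Real.exp (-(D * (ε τ - ε τ₀))) * Real.exp (ε τ₀) *
        (Real.exp (|Real.log lam| * S.dim τ₀) * Real.exp (lam ^ 2 / 2)) *
        Real.exp (|Real.log (lam / Real.sqrt η)| * S.dim τ) := by gcongr
    _ ≤ _ := by
      rw [← Real.exp_add, ← Real.exp_add, ← Real.exp_add, ← Real.exp_add]
      refine Real.exp_le_exp.2 ?_
      have e1 := mul_le_mul_of_nonneg_left hdim₀ (abs_nonneg (Real.log lam))
      have e2 := mul_le_mul_of_nonneg_left hdim (abs_nonneg (Real.log (lam / Real.sqrt η)))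
      have e3 := mul_le_mul_of_nonneg_left hε₀ (by positivity : 0 ≤ lam ^ 2 / 2)
      linarith

/-- The span of the range of the operator of `Z` and a fixed signal `x`. -/
noncomputable def extendedRange (x : EuclideanSpace ℝ (Fin N)) (τ : S.Index) (Z : S.Struct τ) :
    Submodule ℝ (EuclideanSpace ℝ (Fin N)) :=
  LinearMap.range (S.design τ Z).toEuclideanLin ⊔ ℝ ∙ x

theorem finrank_extendedRange_le (x : EuclideanSpace ℝ (Fin N)) (τ : S.Index) (Z : S.Struct τ) :
    Module.finrank ℝ (S.extendedRange x τ Z) ≤ S.dim τ + 1 := by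
  refine (Submodule.finrank_add_le_finrank_add_finrank _ _).trans (add_le_add ?_ ?_)
  · exact (LinearMap.finrank_range_le _).trans_eq finrank_euclideanSpace_fin
  · exact (finrank_span_le_card {x}).trans (by simp)

theorem signal_sub_mem_extendedRange (x : EuclideanSpace ℝ (Fin N)) (τ : S.Index)
    (Z : S.Struct τ) (Q : EuclideanSpace ℝ (Fin (S.dim τ))) :
    S.signal τ Z Q - x ∈ S.extendedRange x τ Z :=
  sub_mem (Submodule.mem_sup_left (LinearMap.mem_range_self _ Q))
    (Submodule.mem_sup_right (Submodule.mem_span_singleton_self x))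

end StructuredLinearModel

/-! ### Exponent comparison and the expected posterior mass. -/

theorem laplace_gaussian_exponent_le {E : Type*} [NormedAddCommGroup E] [InnerProductSpace ℝ E]
    (V : Submodule ℝ E) [V.HasOrthogonalProjection] {a η : ℝ} (ha : 0 ≤ a) (hη : 0 < η)
    {x x₀ : E} (hx : x - x₀ ∈ V) (θ w : E) :
    -(a * ‖x‖) - ‖θ + w - x‖ ^ 2 / 2 ≤ -(a * ‖x₀‖) - ‖θ + w - x₀‖ ^ 2 / 2 +
      (-((1 / 2 - 2 * η) * ‖x - θ‖ ^ 2) + (1 / 2 + η) * ‖x₀ - θ‖ ^ 2 +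
        (a ^ 2 + ‖V.orthogonalProjectionOnto w‖ ^ 2) / η) - η * ‖x - θ‖ ^ 2 := by
  set p := ‖V.orthogonalProjectionOnto w‖
  have hexp : ∀ z : E, ‖θ + w - z‖ ^ 2 = ‖w‖ ^ 2 - 2 * inner ℝ w (z - θ) + ‖z - θ‖ ^ 2 := by
    intro z
    rw [← norm_sub_sq_real]
    congr 2
    abel
  have hinner : inner ℝ w (x - θ) - inner ℝ w (x₀ - θ) ≤ p * ‖x - x₀‖ := by
    rw [← inner_sub_right, sub_sub_sub_cancel_right]
    calc inner ℝ w (x - x₀) = inner ℝ (V.orthogonalProjectionOnto w) (⟨x - x₀, hx⟩ : V) := by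
          rw [real_inner_comm, real_inner_comm (⟨x - x₀, hx⟩ : V)]
          exact (Submodule.inner_orthogonalProjectionOnto_eq_of_mem_left
            (⟨x - x₀, hx⟩ : V) w).symm
      _ ≤ _ := real_inner_le_norm _ _
  have htri : ‖x₀‖ - ‖x‖ ≤ ‖x - x₀‖ := by
    rw [norm_sub_rev]
    exact norm_sub_norm_le _ _
  have htri2 : ‖x - x₀‖ ≤ ‖x - θ‖ + ‖x₀ - θ‖ := by
    rw [← norm_sub_rev θ x₀]
    exact norm_sub_le_norm_sub_add_norm_sub _ _ _
  have hp : 0 ≤ p := norm_nonneg _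
  -- Prior and noise together contribute `(a + p) * ‖x - x₀‖`. It is split at `θ` and absorbed at
  -- the price `η` on each side; a second `η * ‖x - θ‖ ^ 2` is set aside for integration, whence `1
  -- / 2 - 2 * η`.
  have hyoung : ∀ t : ℝ, (a + p) * t ≤ η * t ^ 2 + (a ^ 2 + p ^ 2) / (2 * η) := by
    intro t
    have h1 : η * t ^ 2 + (a ^ 2 + p ^ 2) / (2 * η) - (a + p) * t =
        ((2 * η * t - (a + p)) ^ 2 + (a - p) ^ 2) / (4 * η) := by
      field_simp
      ring
    have h2 : 0 ≤ ((2 * η * t - (a + p)) ^ 2 + (a - p) ^ 2) / (4 * η) := by positivity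
    linarith
  have h1 := hyoung ‖x - θ‖
  have h2 := hyoung ‖x₀ - θ‖
  have h3 : (a ^ 2 + p ^ 2) / η = (a ^ 2 + p ^ 2) / (2 * η) + (a ^ 2 + p ^ 2) / (2 * η) := by
    field_simp
    ring
  have h4 := mul_le_mul_of_nonneg_left htri ha
  have h5 := mul_le_mul_of_nonneg_left htri2 (add_nonneg ha hp)
  rw [hexp x, hexp x₀, h3]
  linarith

namespace StructuredLinearModel

variable {N : ℕ} (S : StructuredLinearModel.{u, v} N)

theorem lintegral_posterior_le {ε : S.Index → ℝ} (D : ℝ) {lam ρ : ℝ} (hlam : 0 < lam)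
    (hρ : 0 < ρ) {Ω : Type w} [MeasurableSpace Ω] {P : Measure Ω} [IsProbabilityMeasure P]
    {W : Ω → EuclideanSpace ℝ (Fin N)} (hW : Measurable W) (hsub : SubGaussianVector P W ρ)
    (hd : ∀ τ, 1 ≤ S.dim τ) (hε : ∀ τ, S.complexity τ ≤ ε τ) (θ : EuclideanSpace ℝ (Fin N))
    {τ₀ : S.Index} {Z₀ : S.Struct τ₀} (hZ₀ : Z₀ ∈ S.regular τ₀)
    (Q₀ : EuclideanSpace ℝ (Fin (S.dim τ₀))) {A : Set S.Param} (hA : MeasurableSet A)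
    (T : Finset S.Index) (hT : ∀ p ∈ A, p.1.1 ∈ T) {η : ℝ} (hη : 0 < η) {b : ℝ}
    (hb : ∀ p ∈ A, -((1 / 2 - 2 * η) * ‖S.signal p.1.1 p.1.2 p.2 - θ‖ ^ 2) +
      (1 / 2 + η) * ‖S.signal τ₀ Z₀ Q₀ - θ‖ ^ 2 ≤ b)
    {s : ℝ} (hs0 : 0 < s) (hs1 : s ≤ 1) (hsη : s ≤ η * ρ / 8) :
    ∫⁻ ω, S.posterior ε D lam (θ + W ω) A ∂P ≤ ∑ τ ∈ T, ENNReal.ofReal (Real.exp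
      (s * (-(D * (ε τ - ε τ₀)) + (1 + |Real.log lam| + lam ^ 2 / 2 + lam ^ 2 / η) * ε τ₀ +
        |Real.log (lam / Real.sqrt η)| * ε τ + b) + 3 * ε τ)) := by
  set x₀ := S.signal τ₀ Z₀ Q₀
  set G : S.Index → ℝ := fun τ => -(D * (ε τ - ε τ₀)) +
    (1 + |Real.log lam| + lam ^ 2 / 2 + lam ^ 2 / η) * ε τ₀ +
      |Real.log (lam / Real.sqrt η)| * ε τ + b with hG
  have hε₀ : 1 ≤ ε τ₀ :=
    le_trans (by exact_mod_cast hd τ₀) (S.dim_le_of_complexity_le (hε τ₀))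
  have hpoint : ∀ ω, S.posterior ε D lam (θ + W ω) A ≤ ∑ τ ∈ T, ∑ Z ∈ S.regular τ,
      ENNReal.ofReal (Real.exp (s * G τ)) * ENNReal.ofReal (Real.exp
        (ρ / 8 * ‖(S.extendedRange x₀ τ Z).orthogonalProjectionOnto (W ω)‖ ^ 2)) := by
    intro ω
    refine (S.posterior_apply_le_sum ε D hlam hd θ (θ + W ω) hA T hT hη hZ₀ Q₀
      (fun τ Z => b + (lam ^ 2 +
        ‖(S.extendedRange x₀ τ Z).orthogonalProjectionOnto (W ω)‖ ^ 2) / η)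
      (fun p hp => ?_) hs0 hs1).trans ?_
    · have h1 := laplace_gaussian_exponent_le (S.extendedRange x₀ p.1.1 p.1.2) hlam.le hη
        (S.signal_sub_mem_extendedRange x₀ p.1.1 p.1.2 p.2) θ (W ω)
      have h2 := hb p hp
      linarith
    · refine Finset.sum_le_sum fun τ _ => Finset.sum_le_sum fun Z hZ => ?_
      rw [← ENNReal.ofReal_mul (Real.exp_pos _).le, ← Real.exp_add]
      set q := ‖(S.extendedRange x₀ τ Z).orthogonalProjectionOnto (W ω)‖ ^ 2
      have hq0 : 0 ≤ q := by positivity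
      calc _ ≤ ENNReal.ofReal (Real.exp (G τ + q / η)) ^ s := by
            refine ENNReal.rpow_le_rpow (ENNReal.ofReal_le_ofReal ?_) hs0.le
            refine (mul_le_mul_of_nonneg_right (S.massFactor_ratio_le hlam hd hε hη ⟨Z, hZ⟩
              ⟨Z₀, hZ₀⟩) (Real.exp_pos _).le).trans ?_
            rw [← Real.exp_add]
            refine Real.exp_le_exp.2 ?_
            have h3 := mul_le_mul_of_nonneg_left hε₀ (by positivity : 0 ≤ lam ^ 2 / η)
            rw [add_div]
            simp only [hG]
            linarith
        _ = ENNReal.ofReal (Real.exp (s * (G τ + q / η))) := by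
            rw [ENNReal.ofReal_rpow_of_pos (Real.exp_pos _), ← Real.exp_mul, mul_comm]
        _ ≤ _ := by
            refine ENNReal.ofReal_le_ofReal (Real.exp_le_exp.2 ?_)
            -- The choice of `s` brings the noise exponent down to the admissible `ρ / 8`.
            have h4 : s * (q / η) ≤ ρ / 8 * q := by
              calc s * (q / η) ≤ η * ρ / 8 * (q / η) := by gcongr
                _ = ρ / 8 * q := by field_simp
            linarith
  have hmeas : ∀ τ (Z : S.Struct τ), Measurable fun ω => ENNReal.ofReal (Real.exp
      (ρ / 8 * ‖(S.extendedRange x₀ τ Z).orthogonalProjectionOnto (W ω)‖ ^ 2)) := by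
    intro τ Z
    have := (S.extendedRange x₀ τ Z).orthogonalProjectionOnto.continuous.measurable.comp hW
    simp only [Function.comp_def] at this
    fun_prop
  refine (lintegral_mono hpoint).trans ?_
  rw [lintegral_finsetSum _ fun τ _ => Finset.measurable_sum _ fun Z _ => (hmeas τ Z).const_mul _]
  refine Finset.sum_le_sum fun τ _ => ?_
  rw [lintegral_finsetSum _ fun Z _ => (hmeas τ Z).const_mul _]
  have hZ : ∀ Z ∈ S.regular τ,
      ∫⁻ ω, ENNReal.ofReal (Real.exp (s * G τ)) * ENNReal.ofReal (Real.exp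
        (ρ / 8 * ‖(S.extendedRange x₀ τ Z).orthogonalProjectionOnto (W ω)‖ ^ 2)) ∂P ≤
      ENNReal.ofReal (Real.exp (s * G τ) * 2 ^ (2 + S.dim τ)) := by
    intro Z _
    rw [lintegral_const_mul _ (hmeas τ Z), ENNReal.ofReal_mul (Real.exp_pos _).le]
    gcongr
    refine (hsub.lintegral_exp_norm_sq_projection_le hW hρ _).trans
      (ENNReal.ofReal_le_ofReal ?_)
    have := S.finrank_extendedRange_le x₀ τ Z
    exact pow_le_pow_right₀ one_le_two (by omega)
  refine (Finset.sum_le_card_nsmul _ _ _ hZ).trans ?_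
  rw [nsmul_eq_mul, ← ENNReal.ofReal_natCast, ← ENNReal.ofReal_mul (Nat.cast_nonneg _)]
  refine ENNReal.ofReal_le_ofReal ?_
  have hdim := S.dim_le_of_complexity_le (hε τ)
  have h1 : (1 : ℝ) ≤ S.dim τ := by exact_mod_cast hd τ
  -- One `exp dim` joins the cardinality to give `exp (ε τ)`, the other factor is at most `exp (2 *
  -- ε τ)`: this is the `3 * ε τ` of the bound.
  have hpow : (2 : ℝ) ^ (2 + S.dim τ) ≤ Real.exp (S.dim τ) * Real.exp (2 * S.dim τ) := by
    have he : (2 : ℝ) ≤ Real.exp 1 := by linarith [Real.add_one_le_exp (1 : ℝ)]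
    calc (2 : ℝ) ^ (2 + S.dim τ) ≤ Real.exp 1 ^ (2 + S.dim τ) := by gcongr
      _ = Real.exp (2 + S.dim τ) := by rw [← Real.exp_nat_mul]; push_cast; ring_nf
      _ ≤ _ := by rw [← Real.exp_add]; exact Real.exp_le_exp.2 (by linarith)
  calc _ ≤ ((S.regular τ).card : ℝ) *
        (Real.exp (s * G τ) * (Real.exp (S.dim τ) * Real.exp (2 * S.dim τ))) := by gcongr
    _ = Real.exp (s * G τ) * (((S.regular τ).card : ℝ) * Real.exp (S.dim τ)) *
        Real.exp (2 * S.dim τ) := by ring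
    _ ≤ Real.exp (s * G τ) * Real.exp (ε τ) * Real.exp (2 * ε τ) := by
        gcongr
        exact S.card_regular_mul_exp_dim_le (hε τ)
    _ = _ := by
        rw [← Real.exp_add, ← Real.exp_add]
        congr 1
        simp only [hG]
        ring

/-- In `7 / s`, three units pay for the sum over structures and the noise moment, four for the sum
over `τ`. -/
theorem lintegral_posterior_le_exp {ε : S.Index → ℝ} {D lam ρ : ℝ} (hlam : 0 < lam)
    (hρ : 0 < ρ) {Ω : Type w} [MeasurableSpace Ω] {P : Measure Ω} [IsProbabilityMeasure P]
    {W : Ω → EuclideanSpace ℝ (Fin N)} (hW : Measurable W) (hsub : SubGaussianVector P W ρ)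
    (hcap : CapacityCondition ε)
    (hd : ∀ τ, 1 ≤ S.dim τ) (hε : ∀ τ, S.complexity τ ≤ ε τ) (θ : EuclideanSpace ℝ (Fin N))
    {τ₀ : S.Index} {Z₀ : S.Struct τ₀} (hZ₀ : Z₀ ∈ S.regular τ₀)
    (Q₀ : EuclideanSpace ℝ (Fin (S.dim τ₀))) {A : Set S.Param} (hA : MeasurableSet A)
    (T : Finset S.Index) (hT : ∀ p ∈ A, p.1.1 ∈ T) {η : ℝ} (hη : 0 < η) {b : ℝ}
    (hb : ∀ p ∈ A, -((1 / 2 - 2 * η) * ‖S.signal p.1.1 p.1.2 p.2 - θ‖ ^ 2) +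
      (1 / 2 + η) * ‖S.signal τ₀ Z₀ Q₀ - θ‖ ^ 2 ≤ b)
    {s : ℝ} (hs0 : 0 < s) (hs1 : s ≤ 1) (hsη : s ≤ η * ρ / 8) {R : ℝ}
    (hR : ∀ τ ∈ T, -(D * (ε τ - ε τ₀)) +
      (1 + |Real.log lam| + lam ^ 2 / 2 + lam ^ 2 / η) * ε τ₀ +
        |Real.log (lam / Real.sqrt η)| * ε τ + b + 7 / s * ε τ ≤ -R) :
    ∫⁻ ω, S.posterior ε D lam (θ + W ω) A ∂P ≤ ENNReal.ofReal (Real.exp (-(s * R))) := by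
  have hε1 : ∀ τ, 1 ≤ ε τ := fun τ =>
    le_trans (by exact_mod_cast hd τ) (S.dim_le_of_complexity_le (hε τ))
  calc _ ≤ _ := S.lintegral_posterior_le D hlam hρ hW hsub hd hε θ hZ₀ Q₀ hA T hT hη hb
        hs0 hs1 hsη
    _ ≤ ∑ τ ∈ T, ENNReal.ofReal (Real.exp (-(s * R)) * Real.exp (-(4 * ε τ))) := by
        refine Finset.sum_le_sum fun τ hτ => ENNReal.ofReal_le_ofReal ?_
        rw [← Real.exp_add]
        refine Real.exp_le_exp.2 ?_
        have h1 := mul_le_mul_of_nonneg_left (hR τ hτ) hs0.le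
        have h2 : s * (7 / s * ε τ) = 7 * ε τ := by field_simp
        rw [mul_add s _ (7 / s * ε τ), h2] at h1
        linarith
    _ = ENNReal.ofReal (Real.exp (-(s * R)) * ∑ τ ∈ T, Real.exp (-(4 * ε τ))) := by
        rw [Finset.mul_sum, ENNReal.ofReal_sum_of_nonneg fun _ _ => by positivity]
    _ ≤ _ := by
        refine ENNReal.ofReal_le_ofReal (mul_le_of_le_one_right (Real.exp_pos _).le ?_)
        exact (Finset.sum_le_univ_sum_of_nonneg fun _ => (Real.exp_pos _).le).trans
          (hcap.sum_exp_neg_le_one hε1)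

end StructuredLinearModel

/-! ### Choice of constants and the two events. -/

theorem theorem1 (lam ρ δ : ℝ) (hlam : 0 < lam) (hρ : 0 < ρ) (hδ0 : 0 < δ) (hδ1 : δ < 1) :
    ∃ D₀ : ℝ, 0 < D₀ ∧ ∀ D : ℝ, D₀ < D →
      ∃ M C' C'' : ℝ, 0 < M ∧ 0 < C' ∧ 0 < C'' ∧
        ∀ (N : ℕ) (S : StructuredLinearModel.{u, v} N) (ε : S.Index → ℝ)
          (Ω : Type w) (_ : MeasurableSpace Ω) (P : Measure Ω) (_ : IsProbabilityMeasure P)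
          (W : Ω → EuclideanSpace ℝ (Fin N)) (θ : EuclideanSpace ℝ (Fin N))
          (τ₀ : S.Index) (Z₀ : S.Struct τ₀) (Q₀ : EuclideanSpace ℝ (Fin (S.dim τ₀))),
          (∀ τ, 1 ≤ S.dim τ) →
          (∀ τ, S.complexity τ ≤ ε τ) →
          Measurable W →
          SubGaussianVector P W ρ →
          CapacityCondition ε →
          Z₀ ∈ S.regular τ₀ →
          (∫⁻ ω, S.posterior ε D lam (θ + W ω)
              {p | (1 + δ) * ε τ₀ + δ * ‖S.signal τ₀ Z₀ Q₀ - θ‖ ^ 2 < ε p.1.1} ∂P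
            ≤ ENNReal.ofReal
                (Real.exp (-(C' * (ε τ₀ + ‖S.signal τ₀ Z₀ Q₀ - θ‖ ^ 2))))) ∧
          (∫⁻ ω, S.posterior ε D lam (θ + W ω)
              {p | (1 + 8 * Real.sqrt (δ / ρ)) * ‖S.signal τ₀ Z₀ Q₀ - θ‖ ^ 2 + M * ε τ₀
                    < ‖S.signal p.1.1 p.1.2 p.2 - θ‖ ^ 2} ∂P
            ≤ ENNReal.ofReal
                (Real.exp (-(C'' * (ε τ₀ + ‖S.signal τ₀ Z₀ Q₀ - θ‖ ^ 2))))) := by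
  set δ₂ := 8 * Real.sqrt (δ / ρ)
  have hδ₂0 : 0 < δ₂ := by positivity
  set η := min δ₂ 1 / 16 with hη
  have hη0 : 0 < η := by positivity
  have hη1 : η ≤ 1 / 16 := by rw [hη]; linarith [min_le_right δ₂ 1]
  have hη2 : η ≤ δ₂ / 16 := by rw [hη]; linarith [min_le_left δ₂ 1]
  set s := min 1 (η * ρ / 8)
  have hs0 : 0 < s := by positivity
  have hs1 : s ≤ 1 := min_le_left _ _
  have hs2 : s ≤ η * ρ / 8 := min_le_right _ _
  set C := 1 + |Real.log lam| + lam ^ 2 / 2 + lam ^ 2 / η with hC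
  have hC0 : 0 < C := by positivity
  set L := |Real.log (lam / Real.sqrt η)| + 7 / s with hL
  have hL0 : 0 < L := by positivity
  -- `L` collects the coefficients of `ε τ` and `C` those of `ε τ₀`. The threshold makes `D * (δ /
  -- 4)` dominate `L` and `D * (δ / 2)` dominate `C + 2`, where the extra two cover `b = r` and the
  -- decay rate.
  refine ⟨4 / δ * L + 2 / δ * (C + 2), by positivity, fun D hD => ?_⟩
  have hD1 : L ≤ D * (δ / 4) := by
    have h1 : 0 < 2 / δ * (C + 2) := by positivity
    have h2 : 4 / δ * L * (δ / 4) = L := by field_simp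
    rw [← h2]
    gcongr
    linarith
  have hD2 : C + 2 ≤ D * (δ / 2) := by
    have h1 : 0 < 4 / δ * L := by positivity
    have h2 : 2 / δ * (C + 2) * (δ / 2) = C + 2 := by field_simp
    rw [← h2]
    gcongr
    linarith
  have hD0 : 0 < D := lt_trans (by positivity) hD
  have hD3 : L ≤ D := hD1.trans (mul_le_of_le_one_right hD0.le (by linarith))
  refine ⟨4 * (D + C + 1), s, s * η, by positivity, hs0, by positivity, ?_⟩
  intro N S ε Ω _ P _ W θ τ₀ Z₀ Q₀ hd hε hW hsub hcap hZ₀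
  classical
  set r := ‖S.signal τ₀ Z₀ Q₀ - θ‖ ^ 2
  have hr0 : 0 ≤ r := by positivity
  have hε1 : ∀ τ, 1 ≤ ε τ := fun τ =>
    le_trans (by exact_mod_cast hd τ) (S.dim_le_of_complexity_le (hε τ))
  constructor
  · refine S.lintegral_posterior_le_exp hlam hρ hW hsub hcap hd hε θ hZ₀ Q₀ ?_
      (Finset.univ.filter fun τ => (1 + δ) * ε τ₀ + δ * r < ε τ)
      (fun p hp => Finset.mem_filter.2 ⟨Finset.mem_univ _, hp⟩) hη0 (b := r) (fun p _ => ?_)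
      hs0 hs1 hs2 (fun τ hτ => ?_)
    · refine measurableSet_lt measurable_const
        (Sigma.measurable_of_comp_mk (f := fun p : S.Param => ε p.1.1) fun i => ?_)
      exact measurable_const (a := ε i.1)
    · have h1 : 0 ≤ (1 / 2 - 2 * η) * ‖S.signal p.1.1 p.1.2 p.2 - θ‖ ^ 2 :=
        mul_nonneg (by linarith) (sq_nonneg _)
      have h2 : (1 / 2 + η) * r ≤ 1 * r := by
        gcongr
        linarith
      linarith
    · have h1 : (1 + δ) * ε τ₀ + δ * r < ε τ := (Finset.mem_filter.1 hτ).2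
      -- The excess complexity is shared between a part that pays the costs in `ε τ` and a part that
      -- pays those in `ε τ₀ + r`.
      have h2 : δ / 4 * ε τ + δ / 2 * (ε τ₀ + r) ≤ ε τ - ε τ₀ := by
        have h3 := mul_le_mul_of_nonneg_left h1.le (by linarith : 0 ≤ 1 - δ / 4)
        have h4 : 0 ≤ δ * (1 - δ) * ε τ₀ :=
          mul_nonneg (mul_nonneg hδ0.le (by linarith)) (by linarith [hε1 τ₀])
        have h5 : 0 ≤ δ * (1 - δ) * r := mul_nonneg (mul_nonneg hδ0.le (by linarith)) hr0
        have h6 : 0 ≤ δ * r := by positivity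
        linarith
      have h3 := mul_le_mul_of_nonneg_left h2 hD0.le
      have h4 := mul_le_mul_of_nonneg_right hD1 (by linarith [hε1 τ] : 0 ≤ ε τ)
      have h5 := mul_le_mul_of_nonneg_right hD2 (by linarith [hε1 τ₀] : 0 ≤ ε τ₀ + r)
      have h6 : 0 ≤ C * r := by positivity
      rw [hL] at h4
      rw [← hC]
      linarith [hε1 τ₀]
  -- No index is excluded here, so `b` must also offset the gain `D * ε τ₀` of simpler models. As `1
  -- / 2 - 2 * η ≥ 1 / 4`, the constant `M = 4 * (D + C + 1)` suffices, and `η ≤ δ₂ / 16` leaves the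
  -- surplus `η * r`.
  · refine (S.lintegral_posterior_le_exp hlam hρ hW hsub hcap hd hε θ hZ₀ Q₀ ?_ Finset.univ
      (fun p _ => Finset.mem_univ _) hη0 (b := -(η * r) - (D + C + 1) * ε τ₀) (fun p hp => ?_)
      hs0 hs1 hs2 (R := ε τ₀ + η * r) (fun τ _ => ?_)).trans ?_
    · refine measurableSet_lt measurable_const (Sigma.measurable_of_comp_mk fun i => ?_)
      exact ((S.measurable_signal i.1 i.2).sub_const θ).norm.pow_const 2
    · have h1 : (1 + δ₂) * r + 4 * (D + C + 1) * ε τ₀ < ‖S.signal p.1.1 p.1.2 p.2 - θ‖ ^ 2 := hp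
      have h2 := mul_le_mul_of_nonneg_left h1.le (by linarith : 0 ≤ 1 / 2 - 2 * η)
      have h3 : 0 ≤ (1 / 4 - 2 * η) * ((D + C + 1) * ε τ₀) :=
        mul_nonneg (by linarith) (mul_nonneg (by positivity) (by linarith [hε1 τ₀]))
      have h4 : 0 ≤ (δ₂ / 16 - η) * r := mul_nonneg (by linarith) hr0
      have h5 : 0 ≤ (1 / 16 - η) * (δ₂ * r) := mul_nonneg (by linarith) (by positivity)
      have h6 : 0 ≤ δ₂ * r := by positivity
      linarith
    · have h1 := mul_le_mul_of_nonneg_right hD3 (by linarith [hε1 τ] : 0 ≤ ε τ)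
      rw [hL] at h1
      rw [← hC]
      linarith
    · refine ENNReal.ofReal_le_ofReal (Real.exp_le_exp.2 ?_)
      have h1 : 0 ≤ s * ((1 - η) * ε τ₀) :=
        mul_nonneg hs0.le (mul_nonneg (by linarith) (by linarith [hε1 τ₀]))
      linarith
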